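/- Let $k$ be an odd positive integer and let $\chi$ be a non-principal primitive Dirichlet character modulo $k$, with complex conjugate $\bar\chi$. Notation: - $G(\chi)=\sum_{v=0}^{k-1}\chi(v)e^{2\pi i v/k}$ is the Gauss sum. - For $\operatorname{Im} z>0$ and $s\in\mathbb C$, $$A_1(z,s:\chi)=\sum_{n=1}^\infty\sum_{m=1}^\infty(-1)^m\chi(m)\chi(n)\,n^{s-1}e^{2\pi i mnz/k},\qquad H_1(z,s:\chi)=(1+e^{\pi i s})A_1(z,s:\chi).$$ - $\mathfrak B_n$ is the Bernoulli function, i.e. the $1$-periodic function with $\mathfrak B_n(x)=B_n(x)$ (the Bernoulli polynomial) for $0\le x<1$, except that $\mathfrak B_1(x)=0$ for $x\in\mathbb Z$; and for $m\ge1$ $$\mathfrak B_{m,\chi}(x)=k^{m-1}\sum_{j=0}^{k-1}\bar\chi(j)\,\mathfrak B_m\!\left(\frac{j+x}{k}\right).$$ - For integers $c>0$, $d$ and $p\ge1$, $$g_2(c,d,z,p,\chi)=\sum_{m=1}^{p}\binom{p+1}{m}\bigl(-(cz+d)\bigr)^{m-1}k^{m-p}\sum_{n=1}^{ck}(-1)^n\chi(n)\,\mathfrak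 B_{p+1-m,\chi}\!\left(\frac{dn}{c}\right)\mathfrak B_m\!\left(\frac{n}{ck}\right).$$ **Theorem.** Let $p\ge1$ be an odd integer, let $a,b,c,d$ be integers with $ad-bc=1$, $c>0$ and $c$ even, and put $Tz=(az+b)/(cz+d)$. (i) If $a\equiv d\equiv0\pmod k$, then for all $z$ with $\operatorname{Im}z>0$, $$G(\bar\chi)(cz+d)^{p-1}H_1(Tz,1-p:\chi)=\bar\chi(b)\chi(c)G(\chi)H_1(z,1-p:\bar\chi)+\bar\chi(-b)\chi(c)\frac{(2\pi i)^p}{(p+1)!}\,g_2(c,d,z,p,\bar\chi).$$ (ii) If $b\equiv c\equiv0\pmod k$, then for all $z$ with $\operatorname{Im}z>0$, $$G(\bar\chi)(cz+d)^{p-1}H_1(Tz,1-p:\chi)=\bar\chi(a)\chi(d)G(\bar\chi)H_1(z,1-p:\chi)+\bar\chi(a)\chi(-d)\frac{(2\pi i)^p}{(p+1)!}\,g_2(c,d,z,p,\chi).$$ -/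

import Mathlib

open scoped Nat

namespace HardyBerndt

/-- The Bernoulli function `𝔅ₙ(x)`: the 1-periodic extension of the Bernoulli polynomial `Bₙ`
from `[0, 1)`, except that `𝔅₁` vanishes at the integers. -/
noncomputable def bernFun (n : ℕ) (x : ℝ) : ℝ :=
  open Classical in
  if n = 1 ∧ Int.fract x = 0 then 0 else bernoulliFun n (Int.fract x)

/-- The generalized Bernoulli function
`𝔅_{m,χ}(x) = k^{m-1} ∑_{j=0}^{k-1} χ̄(j) 𝔅ₘ((j + x)/k)`, for `m ≥ 1`. -/
noncomputable def bernFunChar {k : ℕ} (m : ℕ) (χ : DirichletCharacter ℂ k) (x : ℝ) : ℂ :=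
  (k : ℂ) ^ ((m : ℤ) - 1) *
    ∑ j ∈ Finset.range k, star χ (j : ZMod k) * (bernFun m (((j : ℝ) + x) / k) : ℂ)

/-- The Gauss sum `G(χ) = ∑_{v=0}^{k-1} χ(v) e^{2πiv/k}`. -/
noncomputable def gauss {k : ℕ} [NeZero k] (χ : DirichletCharacter ℂ k) : ℂ :=
  gaussSum χ ZMod.stdAddChar

/-- `A₁(z, s : χ) = ∑_{n ≥ 1} ∑_{m ≥ 1} (-1)^m χ(m) χ(n) n^{s-1} e^{2πimnz/k}`, for `Im z > 0`. -/
noncomputable def A₁ {k : ℕ} (z s : ℂ) (χ : DirichletCharacter ℂ k) : ℂ :=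
  ∑' n : ℕ+, ∑' m : ℕ+, (-1 : ℂ) ^ (m : ℕ) * χ ((m : ℕ) : ZMod k) * χ ((n : ℕ) : ZMod k) *
    ((n : ℕ) : ℂ) ^ (s - 1) *
    Complex.exp (2 * Real.pi * Complex.I * (m : ℕ) * (n : ℕ) * z / k)

/-- `H₁(z, s : χ) = (1 + e^{πis}) A₁(z, s : χ)`. -/
noncomputable def H₁ {k : ℕ} (z s : ℂ) (χ : DirichletCharacter ℂ k) : ℂ :=
  (1 + Complex.exp (Real.pi * Complex.I * s)) * A₁ z s χ

/-- `g₂(c, d, z, p, χ) = ∑_{m=1}^p binom(p+1, m) (-(cz+d))^{m-1} k^{m-p}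
      ∑_{n=1}^{ck} (-1)^n χ(n) 𝔅_{p+1-m,χ}(dn/c) 𝔅ₘ(n/(ck))`. -/
noncomputable def g₂ {k : ℕ} (c d : ℤ) (z : ℂ) (p : ℕ) (χ : DirichletCharacter ℂ k) : ℂ :=
  ∑ m ∈ Finset.Icc 1 p, ((p + 1).choose m : ℂ) * (-(c * z + d)) ^ (m - 1) *
    (k : ℂ) ^ ((m : ℤ) - (p : ℤ)) *
    ∑ n ∈ Finset.Icc (1 : ℤ) (c * k), (-1 : ℂ) ^ n * χ (n : ZMod k) *
      bernFunChar (p + 1 - m) χ ((d : ℝ) * n / c) * (bernFun m ((n : ℝ) / (c * k)) : ℂ)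

end HardyBerndt

namespace HardyBerndt

/-! ### Periodic sums, additive characters and partial sums of the cotangent series -/

section Sums

open Filter Topology Complex

/-! The transformation law is a partial fraction identity summed over a two-dimensional box. Put α =
cz + d and N = ck. For nonzero integers x, y, a finite geometric sum gives α^p x^(-p) / (αy - x) -
y^(-p) / (αy - x) = ∑_{m=1}^p α^(m-1) / (x^m y^(p+1-m)). Multiply by the doubly N-periodic weight
w(x, y) = ∑_{n mod ck} ∑_{j mod k} (-1)^n ψ(n) ψ̄(j) e((-nx + (jc + dn)y) / N), with e(t) =
exp(2πit), and sum over -NM ≤ x, y < NM. All three sums are finite, so their order is free; the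
theorem is the limit M → ∞.

On the right, for fixed n and j the sum is a product of two Bernoulli Fourier series, and the limit
is a multiple of `g₂` (`tendsto_sum_weight_div_pow`, `g₂_eq_sum_range`).

On the left, the first term is summed over y first and the second over x first. The cotangent
expansion turns the inner sum into exponentials weighted by the partial Fourier transform of w. In x
the transform is a Gauss sum times (-1)^m ψ(m) ψ(y) (`sum_weight_mul_expInt_left`), which yields
`H₁` at z. In y, the relation ad - bc = 1 reduces it to a sum over t mod k
(`sum_weight_mul_expInt_right`), and either congruence hypothesis separates the characters there;
this yields `H₁` at Tz because (a - 1/α)/c = Tz. Case (ii) takes ψ = χ, case (i) takes ψ = χ̄.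

The double series need not converge absolutely as they stand. Since w has mean zero in each
variable, grouping the inner sum into blocks of length N restores absolute convergence
(`summable_block_sums`), so box limits equal iterated sums (`tendsto_box_sum`). -/

lemma sum_Ico_neg_succ (f : ℤ → ℂ) (M : ℕ) :
    ∑ x ∈ Finset.Ico (-((M + 1 : ℕ) : ℤ)) ((M + 1 : ℕ) : ℤ), f x =
      f (-(M + 1)) + ∑ x ∈ Finset.Ico (-(M : ℤ)) M, f x + f M := by
  have h : Finset.Ico (-((M + 1 : ℕ) : ℤ)) ((M + 1 : ℕ) : ℤ) =
      insert (-(M + 1) : ℤ) (insert (M : ℤ) (Finset.Ico (-(M : ℤ)) M)) := by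
    ext x
    simp only [Finset.mem_Ico, Finset.mem_insert]
    push_cast
    lia
  rw [h, Finset.sum_insert, Finset.sum_insert]
  · ring
  · simp
  · simp only [Finset.mem_Ico, Finset.mem_insert]
    lia

lemma sum_Ico_blocks (f : ℤ → ℂ) {N : ℕ} (hN : 0 < N) (M : ℕ) :
    ∑ x ∈ Finset.Ico (-((N * M : ℕ) : ℤ)) ((N * M : ℕ) : ℤ), f x =
      ∑ b ∈ Finset.Ico (-(M : ℤ)) M, ∑ i ∈ Finset.range N, f (N * b + i) := by
  have hN' : (0 : ℤ) < N := by exact_mod_cast hN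
  rw [← Finset.sum_product']
  refine Finset.sum_nbij' (fun x ↦ (x / N, (x % N).toNat)) (fun q ↦ N * q.1 + q.2) ?_ ?_ ?_ ?_ ?_
  · intro x hx
    simp only [Finset.mem_Ico, Finset.mem_product, Finset.mem_range] at hx ⊢
    have h1 := Int.emod_nonneg x hN'.ne'
    have h2 := Int.emod_lt_of_pos x hN'
    refine ⟨⟨?_, ?_⟩, by lia⟩
    · rw [Int.le_ediv_iff_mul_le hN']
      push_cast at hx
      nlinarith [hx.1]
    · rw [Int.ediv_lt_iff_lt_mul hN']
      push_cast at hx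
      nlinarith [hx.2]
  · rintro ⟨b, i⟩ hx
    simp only [Finset.mem_Ico, Finset.mem_product, Finset.mem_range] at hx ⊢
    obtain ⟨⟨h1, h2⟩, h3⟩ := hx
    have h3' : (i : ℤ) < N := by exact_mod_cast h3
    push_cast
    constructor
    · nlinarith
    · nlinarith
  · intro x hx
    have h1 := Int.emod_nonneg x hN'.ne'
    have h2 := Int.mul_ediv_add_emod x N
    simp only
    rw [Int.toNat_of_nonneg h1]
    exact h2
  · rintro ⟨b, i⟩ hx
    simp only [Finset.mem_Ico, Finset.mem_product, Finset.mem_range] at hx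
    have h3' : (i : ℤ) < N := by exact_mod_cast hx.2
    have e1 : ((N : ℤ) * b + i) / N = b := by
      rw [Int.add_comm, Int.add_mul_ediv_left _ _ hN'.ne', Int.ediv_eq_zero_of_lt (by lia) h3']
      simp
    have e2 : ((N : ℤ) * b + i) % N = i := by
      rw [Int.add_comm, Int.add_mul_emod_self_left, Int.emod_eq_of_lt (by lia) h3']
    simp [e1, e2]
  · intro x hx
    have h1 := Int.emod_nonneg x hN'.ne'
    simp only
    rw [Int.toNat_of_nonneg h1, Int.mul_ediv_add_emod]

lemma periodic_add_mul {f : ℤ → ℂ} {N : ℕ} (hf : ∀ x, f (x + N) = f x) (x b : ℤ) :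
    f (N * b + x) = f x := by
  have h : Function.Periodic f (N : ℤ) := hf
  have := h.int_mul b x
  rw [← this]
  congr 1
  push_cast
  ring

lemma sum_range_shift {f : ℤ → ℂ} {N : ℕ} (hf : ∀ x, f (x + N) = f x) (s : ℤ) :
    ∑ i ∈ Finset.range N, f (i + s) = ∑ i ∈ Finset.range N, f i := by
  have step : ∀ s : ℤ, ∑ i ∈ Finset.range N, f (i + (s + 1)) =
      ∑ i ∈ Finset.range N, f (i + s) := by
    intro s
    have h1 := Finset.sum_range_succ (fun i : ℕ ↦ f (i + s)) N
    have h2 := Finset.sum_range_succ' (fun i : ℕ ↦ f (i + s)) N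
    rw [h1] at h2
    have h3 : f (N + s) = f ((0 : ℕ) + s) := by
      rw [add_comm, hf]
      simp
    rw [h3] at h2
    have h4 := add_right_cancel h2
    rw [h4]
    refine Finset.sum_congr rfl fun i _ ↦ ?_
    push_cast
    ring_nf
  induction s with
  | zero => simp
  | succ n ih => rw [step, ih]
  | pred n ih =>
    rw [← ih, ← step]
    simp

lemma sum_Icc_eq_sum_range {f : ℤ → ℂ} {N : ℕ} (hf : ∀ x, f (x + N) = f x) :
    ∑ n ∈ Finset.Icc (1 : ℤ) N, f n = ∑ i ∈ Finset.range N, f i := by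
  rw [← sum_range_shift hf 1]
  refine Finset.sum_nbij' (fun n ↦ (n - 1).toNat) (fun i ↦ i + 1) ?_ ?_ ?_ ?_ ?_
  · intro a ha
    simp only [Finset.mem_Icc, Finset.mem_range] at *
    lia
  · intro a ha
    simp only [Finset.mem_Icc, Finset.mem_range] at *
    lia
  · intro a ha
    simp only [Finset.mem_Icc] at *
    lia
  · intro a ha
    simp
  · intro a ha
    simp only [Finset.mem_Icc] at *
    congr 1
    lia

/-- The additive character `a ↦ e^{2πia/N}` of the integers. -/
noncomputable def expInt (N : ℕ) (a : ℤ) : ℂ := exp (2 * Real.pi * I * a / N)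

lemma expInt_add (N : ℕ) (a b : ℤ) : expInt N (a + b) = expInt N a * expInt N b := by
  rw [expInt, expInt, expInt, ← exp_add]
  push_cast
  ring_nf

@[simp] lemma expInt_zero (N : ℕ) : expInt N 0 = 1 := by simp [expInt]

lemma norm_expInt (N : ℕ) (a : ℤ) : ‖expInt N a‖ = 1 := by
  have : expInt N a = exp ((2 * Real.pi * a / N : ℝ) * I) := by
    rw [expInt]
    push_cast
    ring_nf
  rw [this, norm_exp_ofReal_mul_I]

lemma expInt_mul_self {N : ℕ} (hN : 0 < N) (a : ℤ) : expInt N (N * a) = 1 := by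
  have : (N : ℂ) ≠ 0 := by exact_mod_cast hN.ne'
  rw [expInt, exp_eq_one_iff]
  refine ⟨a, ?_⟩
  push_cast
  field_simp

lemma expInt_mul_mul {c k : ℕ} (hc : 0 < c) (a : ℤ) : expInt (c * k) (c * a) = expInt k a := by
  have : (c : ℂ) ≠ 0 := by exact_mod_cast hc.ne'
  rw [expInt, expInt]
  push_cast
  congr 1
  rw [← mul_div_mul_left (2 * Real.pi * I * a) (k : ℂ) this]
  ring_nf

lemma expInt_eq_one_iff {N : ℕ} (hN : 0 < N) (a : ℤ) : expInt N a = 1 ↔ (N : ℤ) ∣ a := by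
  constructor
  · intro h
    rw [expInt, exp_eq_one_iff] at h
    obtain ⟨n, hn⟩ := h
    have hN' : (N : ℂ) ≠ 0 := by exact_mod_cast hN.ne'
    have h2 := two_pi_I_ne_zero
    refine ⟨n, ?_⟩
    have h3 : (2 * Real.pi * I) * (a : ℂ) = (2 * Real.pi * I) * (N * n : ℂ) := by
      field_simp at hn
      linear_combination (2 * Real.pi * I) * hn
    exact_mod_cast mul_left_cancel₀ h2 h3
  · rintro ⟨n, rfl⟩
    exact expInt_mul_self hN n

lemma expInt_nat_mul (N : ℕ) (a : ℤ) (i : ℕ) : expInt N (a * i) = expInt N a ^ i := by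
  rw [expInt, expInt, ← exp_nat_mul]
  push_cast
  ring_nf

lemma sum_expInt {N : ℕ} (hN : 0 < N) (a : ℤ) :
    ∑ i ∈ Finset.range N, expInt N (a * i) = if (N : ℤ) ∣ a then (N : ℂ) else 0 := by
  simp_rw [expInt_nat_mul]
  split_ifs with h
  · rw [(expInt_eq_one_iff hN a).2 h]
    simp
  · have h1 : expInt N a ≠ 1 := fun h' ↦ h ((expInt_eq_one_iff hN a).1 h')
    rw [geom_sum_eq h1, ← expInt_nat_mul, mul_comm, expInt_mul_self hN]
    simp

/-- The half-open interval lacks only the endpoint term 1/(u + M) of the symmetric sum, and that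
term tends to 0; what remains is the Mittag-Leffler series of the cotangent. -/
lemma tendsto_sum_Ico_inv_add {u : ℂ} (hu : u.im ≠ 0) :
    Tendsto (fun M : ℕ ↦ ∑ b ∈ Finset.Ico (-(M : ℤ)) M, 1 / (u + b)) atTop
      (𝓝 (Real.pi * cot (Real.pi * u))) := by
  have hu' : u ∈ Complex.integerComplement := by
    rw [Complex.mem_integerComplement_iff]
    rintro ⟨n, rfl⟩
    simp at hu
  have h1 := tendsto_logDeriv_euler_cot_sub hu'
  have h2 : Tendsto (fun M : ℕ ↦ 1 / (u + M)) atTop (𝓝 0) := by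
    have := EisensteinSeries.tendsto_zero_inv_linear u 1
    simpa using this
  have h3 : ∀ M : ℕ, ∑ b ∈ Finset.Ico (-(M : ℤ)) M, 1 / (u + b) =
      1 / u + ∑ j ∈ Finset.range M, cotTerm u j - 1 / (u + M) := by
    intro M
    induction M with
    | zero => simp
    | succ n ih =>
      rw [sum_Ico_neg_succ, ih, Finset.sum_range_succ, cotTerm]
      push_cast
      ring
  simp_rw [h3]
  convert (h1.const_add (1 / u)).sub h2 using 2
  ring

lemma pi_mul_cot_eq_of_im_pos {v : ℂ} (hv : 0 < v.im) :
    HasSum (fun m : ℕ+ ↦ -2 * Real.pi * I * exp (2 * Real.pi * I * (m : ℕ) * v))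
      (Real.pi * cot (Real.pi * v) + Real.pi * I) := by
  have h := pi_mul_cot_pi_q_exp ⟨v, hv⟩
  have hn : ‖exp (2 * Real.pi * I * v)‖ < 1 := UpperHalfPlane.norm_exp_two_pi_I_lt_one ⟨v, hv⟩
  have hs := (summable_geometric_of_norm_lt_one hn).hasSum
  have hs1 := (hasSum_nat_add_iff' 1).2 hs
  rw [← hasSum_pnat_iff_hasSum_succ (f := fun m : ℕ ↦ exp (2 * Real.pi * I * v) ^ m)] at hs1
  have hs2 := hs1.mul_left (-2 * Real.pi * I)
  convert! hs2 using 1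
  · ext m
    rw [← exp_nat_mul]
    ring_nf
  · simp only at h
    rw [h]
    simp
    ring

lemma pi_mul_cot_eq_of_im_neg {v : ℂ} (hv : v.im < 0) :
    HasSum (fun m : ℕ+ ↦ 2 * Real.pi * I * exp (-(2 * Real.pi * I * (m : ℕ) * v)))
      (Real.pi * cot (Real.pi * v) - Real.pi * I) := by
  have h := (pi_mul_cot_eq_of_im_pos (v := -v) (by simpa using hv)).neg
  convert! h using 1
  · ext m
    ring_nf
  · rw [mul_neg, cot, cot, cos_neg, sin_neg]
    ring

lemma tendsto_sum_div_add_cot {N : ℕ} (hN : 0 < N) {g : ℤ → ℂ} (hg : ∀ x, g (x + N) = g x)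
    {u : ℂ} (hu : u.im ≠ 0) :
    Tendsto (fun M : ℕ ↦ ∑ x ∈ Finset.Ico (-((N * M : ℕ) : ℤ)) ((N * M : ℕ) : ℤ), g x / (u + x))
      atTop (𝓝 (∑ i ∈ Finset.range N, g i / N * (Real.pi * cot (Real.pi * ((u + i) / N))))) := by
  have hN' : (N : ℂ) ≠ 0 := by exact_mod_cast hN.ne'
  have hNr : (N : ℝ) ≠ 0 := by exact_mod_cast hN.ne'
  have h1 : ∀ M : ℕ, ∑ x ∈ Finset.Ico (-((N * M : ℕ) : ℤ)) ((N * M : ℕ) : ℤ), g x / (u + x) =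
      ∑ i ∈ Finset.range N, g i / N * ∑ b ∈ Finset.Ico (-(M : ℤ)) M, 1 / ((u + i) / N + b) := by
    intro M
    rw [sum_Ico_blocks _ hN, Finset.sum_comm]
    refine Finset.sum_congr rfl fun i _ ↦ ?_
    rw [Finset.mul_sum]
    refine Finset.sum_congr rfl fun b _ ↦ ?_
    rw [periodic_add_mul hg, div_mul_div_comm, mul_one]
    congr 1
    push_cast
    field_simp
    ring
  simp_rw [h1]
  refine tendsto_finsetSum _ fun i _ ↦ Tendsto.const_mul _ (tendsto_sum_Ico_inv_add ?_)
  have : ((u + i) / N).im = u.im / N := by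
    rw [show (N : ℂ) = ((N : ℝ) : ℂ) by simp, div_ofReal_im]
    simp
  rw [this]
  exact div_ne_zero hu hNr

/-- A Lipschitz-type formula: splitting by residues mod N gives cotangents, which expand in powers
of e(u/N). The mean-zero hypothesis cancels the constant -πi of each cotangent. -/
lemma tendsto_sum_div_add_of_im_pos {N : ℕ} (hN : 0 < N) {g : ℤ → ℂ}
    (hg : ∀ x, g (x + N) = g x) (hg0 : ∑ i ∈ Finset.range N, g i = 0) {u : ℂ} (hu : 0 < u.im) :
    Tendsto (fun M : ℕ ↦ ∑ x ∈ Finset.Ico (-((N * M : ℕ) : ℤ)) ((N * M : ℕ) : ℤ), g x / (u + x))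
      atTop (𝓝 (-2 * Real.pi * I / N * ∑' m : ℕ+, (∑ i ∈ Finset.range N, g i * expInt N (m * i)) *
        exp (2 * Real.pi * I * (m : ℕ) * u / N))) := by
  have hN' : (N : ℂ) ≠ 0 := by exact_mod_cast hN.ne'
  have hNr : (0 : ℝ) < N := by exact_mod_cast hN
  convert tendsto_sum_div_add_cot hN hg hu.ne' using 2
  rw [← tsum_mul_left]
  refine HasSum.tsum_eq ?_
  have h : ∀ i ∈ Finset.range N, HasSum
      (fun m : ℕ+ ↦ g i / N * (-2 * Real.pi * I * exp (2 * Real.pi * I * (m : ℕ) * ((u + i) / N))))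
      (g i / N * (Real.pi * cot (Real.pi * ((u + i) / N)) + Real.pi * I)) := by
    intro i _
    refine (pi_mul_cot_eq_of_im_pos ?_).mul_left _
    rw [show (N : ℂ) = ((N : ℝ) : ℂ) by simp, div_ofReal_im]
    simp only [add_im, natCast_im, add_zero]
    positivity
  convert! hasSum_sum h using 1
  · ext m
    rw [Finset.sum_mul, Finset.mul_sum]
    refine Finset.sum_congr rfl fun i _ ↦ ?_
    rw [mul_assoc (g i), expInt, ← exp_add]
    have : 2 * Real.pi * I * ((((m : ℕ) : ℤ) * (i : ℤ) : ℤ) : ℂ) / N +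
        2 * Real.pi * I * (m : ℕ) * u / N = 2 * Real.pi * I * (m : ℕ) * ((u + i) / N) := by
      push_cast
      field_simp
      ring
    rw [this]
    ring
  · simp_rw [mul_add]
    rw [Finset.sum_add_distrib, ← Finset.sum_mul, ← Finset.sum_div, hg0]
    simp

lemma tendsto_sum_div_add_of_im_neg {N : ℕ} (hN : 0 < N) {g : ℤ → ℂ}
    (hg : ∀ x, g (x + N) = g x) (hg0 : ∑ i ∈ Finset.range N, g i = 0) {u : ℂ} (hu : u.im < 0) :
    Tendsto (fun M : ℕ ↦ ∑ x ∈ Finset.Ico (-((N * M : ℕ) : ℤ)) ((N * M : ℕ) : ℤ), g x / (u + x))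
      atTop (𝓝 (2 * Real.pi * I / N * ∑' m : ℕ+, (∑ i ∈ Finset.range N, g i * expInt N (-m * i)) *
        exp (-(2 * Real.pi * I * (m : ℕ) * u / N)))) := by
  have hN' : (N : ℂ) ≠ 0 := by exact_mod_cast hN.ne'
  have hNr : (0 : ℝ) < N := by exact_mod_cast hN
  convert tendsto_sum_div_add_cot hN hg hu.ne using 2
  rw [← tsum_mul_left]
  refine HasSum.tsum_eq ?_
  have h : ∀ i ∈ Finset.range N, HasSum
      (fun m : ℕ+ ↦ g i / N * (2 * Real.pi * I * exp (-(2 * Real.pi * I * (m : ℕ) * ((u + i) / N)))))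
      (g i / N * (Real.pi * cot (Real.pi * ((u + i) / N)) - Real.pi * I)) := by
    intro i _
    refine (pi_mul_cot_eq_of_im_neg ?_).mul_left _
    rw [show (N : ℂ) = ((N : ℝ) : ℂ) by simp, div_ofReal_im]
    simp only [add_im, natCast_im, add_zero]
    exact div_neg_of_neg_of_pos hu hNr
  convert! hasSum_sum h using 1
  · ext m
    rw [Finset.sum_mul, Finset.mul_sum]
    refine Finset.sum_congr rfl fun i _ ↦ ?_
    rw [mul_assoc (g i), expInt, ← exp_add]
    have : 2 * Real.pi * I * ((-((m : ℕ) : ℤ) * (i : ℤ) : ℤ) : ℂ) / N +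
        -(2 * Real.pi * I * (m : ℕ) * u / N) = -(2 * Real.pi * I * (m : ℕ) * ((u + i) / N)) := by
      push_cast
      field_simp
      ring
    rw [this]
    ring
  · simp_rw [mul_sub]
    rw [Finset.sum_sub_distrib, ← Finset.sum_mul, ← Finset.sum_div, hg0]
    simp

end Sums

/-! ### Absolute convergence after grouping into blocks, and limits over boxes -/

section Summability

open Filter Topology Complex

lemma exists_lower_bound_norm_linear {α : ℂ} (hα : α.im ≠ 0) :
    ∃ ε : ℝ, 0 < ε ∧ ∀ y t : ℝ, ε * |y| ≤ ‖α * y + t‖ ∧ ε * |t| ≤ ‖α * y + t‖ := by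
  have h0 : 0 < |α.im| := abs_pos.2 hα
  set r := |α.im|
  have hn : 0 ≤ ‖α‖ := norm_nonneg α
  refine ⟨r / (1 + r + ‖α‖), by positivity, fun y t ↦ ?_⟩
  have h1 : r * |y| ≤ ‖α * y + t‖ := by
    have := abs_im_le_norm (α * y + t)
    simpa [abs_mul] using this
  have h2 : |t| ≤ ‖α * y + t‖ + ‖α‖ * |y| := by
    have := norm_sub_le (α * y + t) (α * y)
    simpa using this
  have hD : 0 < 1 + r + ‖α‖ := by positivity
  have hY := abs_nonneg y
  have hZ := norm_nonneg (α * y + t)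
  constructor
  · rw [div_mul_eq_mul_div, div_le_iff₀ hD]
    nlinarith
  · rw [div_mul_eq_mul_div, div_le_iff₀ hD]
    nlinarith

lemma summable_int_abs_add_one_rpow : Summable fun n : ℤ ↦ (|(n : ℝ)| + 1) ^ (-(3 / 2) : ℝ) := by
  have h : Summable fun n : ℕ ↦ ((n : ℝ) + 1) ^ (-(3 / 2) : ℝ) := by
    have := (summable_nat_add_iff 1).2 (Real.summable_nat_rpow (p := -(3 / 2)).2 (by norm_num))
    simpa using this
  refine Summable.of_nat_of_neg ?_ ?_ <;> simpa using h

lemma inv_mul_inv_sq_le {Y B D : ℝ} (hY : 0 < Y) (hB : 0 < B) (h1 : Y ≤ D) (h2 : B ≤ D) :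
    Y⁻¹ * (D ^ 2)⁻¹ ≤ Y ^ (-(3 / 2) : ℝ) * B ^ (-(3 / 2) : ℝ) := by
  have hD : 0 < D := hY.trans_le h1
  have e1 : Y ^ (-(3 / 2) : ℝ) = Y⁻¹ * Y ^ (-(1 / 2) : ℝ) := by
    rw [← Real.rpow_neg_one, ← Real.rpow_add hY]
    norm_num
  have e2 : (D ^ 2)⁻¹ = D ^ (-(1 / 2) : ℝ) * D ^ (-(3 / 2) : ℝ) := by
    rw [← Real.rpow_add hD, ← Real.rpow_natCast, ← Real.rpow_neg hD.le]
    norm_num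
  rw [e1, e2, mul_assoc]
  have a1 := Real.rpow_le_rpow_of_nonpos hY h1 (show (-(1 / 2) : ℝ) ≤ 0 by norm_num)
  have a2 := Real.rpow_le_rpow_of_nonpos hB h2 (show (-(3 / 2) : ℝ) ≤ 0 by norm_num)
  gcongr

lemma summable_block_sums {N : ℕ} (hN : 0 < N) {α : ℂ} (hα : α.im ≠ 0) {p : ℕ} (hp : p ≠ 0)
    {w : ℤ → ℤ → ℂ} {C : ℝ} (hC : ∀ y x, ‖w y x‖ ≤ C)
    (h0 : ∀ y, ∑ i ∈ Finset.range N, w y i = 0) :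
    Summable fun q : ℤ × ℤ ↦ ((q.1 : ℂ) ^ p)⁻¹ *
      ∑ i ∈ Finset.range N, w q.1 i / (α * q.1 + (N * q.2 + i : ℤ)) := by
  obtain ⟨ε, hε, hb⟩ := exists_lower_bound_norm_linear hα
  have hC0 : 0 ≤ C := (norm_nonneg _).trans (hC 0 0)
  have hs := (summable_int_abs_add_one_rpow.mul_of_nonneg summable_int_abs_add_one_rpow
    (fun _ ↦ by positivity) (fun _ ↦ by positivity)).mul_left (2 * (N * (C * N * (4 / ε ^ 2))))
  refine Summable.of_norm_bounded hs ?_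
  rintro ⟨y, b⟩
  simp only
  rcases eq_or_ne y 0 with rfl | hy
  · simp only [Int.cast_zero, zero_pow hp, inv_zero, zero_mul, norm_zero]
    positivity
  have hy1 : (1 : ℝ) ≤ |(y : ℝ)| := by exact_mod_cast Int.one_le_abs hy
  have hyn : (1 : ℝ) ≤ ‖(y : ℂ)‖ := by simpa using hy1
  set m : ℝ := max (|(y : ℝ)| + 1) (|(b : ℝ)| + 1) with hm
  have hm1 : |(y : ℝ)| + 1 ≤ m := le_max_left _ _
  have hm2 : |(b : ℝ)| + 1 ≤ m := le_max_right _ _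
  have hm0 : 0 < m := by positivity
  have key : ∀ i : ℕ, i < N → ε / 2 * m ≤ ‖α * y + (N * b + i : ℤ)‖ := by
    intro i hi
    obtain ⟨k1, k2⟩ := hb y (N * b + i)
    have k3 : |(b : ℝ)| ≤ |(N * b + i : ℝ)| := by
      have : |b| ≤ |N * b + (i : ℤ)| := by
        have hi' : (i : ℤ) + 1 ≤ N := by exact_mod_cast hi
        have hN1 : (1 : ℤ) ≤ N := by exact_mod_cast hN
        rcases le_or_gt 0 b with hb0 | hb0
        · rw [abs_of_nonneg hb0, abs_of_nonneg (by positivity)]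
          nlinarith
        · rw [abs_of_neg hb0, abs_of_nonpos (by nlinarith)]
          nlinarith
      exact_mod_cast this
    have k4 : ε * |(b : ℝ)| ≤ ‖α * y + (N * b + i : ℤ)‖ := by
      refine le_trans (mul_le_mul_of_nonneg_left k3 hε.le) ?_
      simpa using k2
    have k5 : ε * |(y : ℝ)| ≤ ‖α * y + (N * b + i : ℤ)‖ := by simpa using k1
    rcases max_cases (|(y : ℝ)| + 1) (|(b : ℝ)| + 1) with ⟨hmm, _⟩ | ⟨hmm, _⟩
    · rw [hm, hmm]
      nlinarith
    · rw [hm, hmm]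
      nlinarith
  have hpos : 0 < ε / 2 * m := by positivity
  have hD := key 0 hN
  have hD0 : α * y + (N * b : ℤ) ≠ 0 := by
    rw [← norm_pos_iff]
    simpa using hpos.trans_le hD
  -- Since the weights of a block sum to zero, the constant 1/(αy + Nb) may be subtracted from every
  -- term; each difference gains one more power of decay.
  have e : ∑ i ∈ Finset.range N, w y i / (α * y + (N * b + i : ℤ)) =
      ∑ i ∈ Finset.range N, -(w y i * i) / ((α * y + (N * b : ℤ)) * (α * y + (N * b + i : ℤ))) := by
    rw [← sub_zero (∑ i ∈ Finset.range N, w y i / (α * y + (N * b + i : ℤ))),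
      ← zero_div (α * y + (N * b : ℤ)), ← h0 y, Finset.sum_div, ← Finset.sum_sub_distrib]
    refine Finset.sum_congr rfl fun i hi ↦ ?_
    have h1 : α * y + (N * b + i : ℤ) ≠ 0 := by
      rw [← norm_pos_iff]
      exact hpos.trans_le (key i (Finset.mem_range.1 hi))
    field_simp
    push_cast
    ring
  rw [e, norm_mul]
  have b1 : ‖((y : ℂ) ^ p)⁻¹‖ ≤ 2 * (|(y : ℝ)| + 1)⁻¹ := by
    rw [norm_inv, norm_pow]
    have : ‖(y : ℂ)‖ ≤ ‖(y : ℂ)‖ ^ p := le_self_pow₀ hyn hp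
    have hyn' : ‖(y : ℂ)‖ = |(y : ℝ)| := by simp
    rw [← div_eq_mul_inv, inv_eq_one_div, div_le_div_iff₀ (by positivity) (by positivity)]
    nlinarith
  have b2 : ‖∑ i ∈ Finset.range N,
      -(w y i * i) / ((α * y + (N * b : ℤ)) * (α * y + (N * b + i : ℤ)))‖ ≤
      N * (C * N * (4 / ε ^ 2) * (m ^ 2)⁻¹) := by
    refine (norm_sum_le _ _).trans ?_
    refine (Finset.sum_le_card_nsmul _ _ (C * N * (4 / ε ^ 2) * (m ^ 2)⁻¹) fun i hi ↦ ?_).trans_eq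
      (by rw [Finset.card_range, nsmul_eq_mul])
    have hi' := Finset.mem_range.1 hi
    rw [norm_div, norm_neg, norm_mul, norm_mul]
    have c1 : ‖w y i‖ * ‖(i : ℂ)‖ ≤ C * N := by
      have : (i : ℝ) ≤ N := by exact_mod_cast hi'.le
      gcongr
      · exact hC y i
      · simpa using this
    have c2 : (ε / 2 * m) * (ε / 2 * m) ≤
        ‖α * y + (N * b : ℤ)‖ * ‖α * y + (N * b + i : ℤ)‖ := by
      refine mul_le_mul ?_ (key i hi') hpos.le (norm_nonneg _)
      simpa using hD
    calc _ ≤ C * N / ((ε / 2 * m) * (ε / 2 * m)) := by gcongr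
      _ = _ := by
        field_simp
        norm_num
  have b3 := inv_mul_inv_sq_le (by positivity) (by positivity) hm1 hm2
  calc _ ≤ 2 * (|(y : ℝ)| + 1)⁻¹ * (N * (C * N * (4 / ε ^ 2) * (m ^ 2)⁻¹)) := by gcongr
    _ = 2 * (N * (C * N * (4 / ε ^ 2))) * ((|(y : ℝ)| + 1)⁻¹ * (m ^ 2)⁻¹) := by ring
    _ ≤ _ := by gcongr

lemma tendsto_Ico_neg_atTop : Tendsto (fun M : ℕ ↦ Finset.Ico (-(M : ℤ)) M) atTop atTop := by
  refine tendsto_atTop_finset_of_monotone ?_ ?_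
  · intro a b hab
    have : (a : ℤ) ≤ b := by exact_mod_cast hab
    exact Finset.Ico_subset_Ico (by lia) this
  · intro x
    refine ⟨x.natAbs + 1, ?_⟩
    simp only [Finset.mem_Ico]
    lia

lemma tendsto_Ico_neg_mul_atTop {N : ℕ} (hN : 0 < N) :
    Tendsto (fun M : ℕ ↦ Finset.Ico (-((N * M : ℕ) : ℤ)) ((N * M : ℕ) : ℤ)) atTop atTop :=
  tendsto_Ico_neg_atTop.comp (tendsto_id.const_mul_atTop' hN)

/-- The block sums form an absolutely summable family on pairs (y, b), so its sum along boxes and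
its sum fibre by fibre agree. The row y = 0 needs no limit because (0 ^ p)⁻¹ = 0. -/
lemma tendsto_box_sum {N : ℕ} (hN : 0 < N) {α : ℂ} (hα : α.im ≠ 0) {p : ℕ} (hp : p ≠ 0)
    {w : ℤ → ℤ → ℂ} {C : ℝ} (hC : ∀ y x, ‖w y x‖ ≤ C) (hw : ∀ y x, w y (x + N) = w y x)
    (h0 : ∀ y, ∑ i ∈ Finset.range N, w y i = 0) {L : ℤ → ℂ}
    (hL : ∀ y ≠ 0, Tendsto (fun M : ℕ ↦ ∑ x ∈ Finset.Ico (-((N * M : ℕ) : ℤ)) ((N * M : ℕ) : ℤ),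
      w y x / (α * y + x)) atTop (𝓝 (L y))) :
    Summable (fun y : ℤ ↦ ((y : ℂ) ^ p)⁻¹ * L y) ∧
    Tendsto (fun M : ℕ ↦ ∑ y ∈ Finset.Ico (-((N * M : ℕ) : ℤ)) ((N * M : ℕ) : ℤ),
      ∑ x ∈ Finset.Ico (-((N * M : ℕ) : ℤ)) ((N * M : ℕ) : ℤ),
        ((y : ℂ) ^ p)⁻¹ * (w y x / (α * y + x))) atTop (𝓝 (∑' y : ℤ, ((y : ℂ) ^ p)⁻¹ * L y)) := by
  have hS := summable_block_sums hN hα hp hC h0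
  obtain ⟨F, hF⟩ : ∃ F : ℤ × ℤ → ℂ, F = fun q : ℤ × ℤ ↦ ((q.1 : ℂ) ^ p)⁻¹ *
      ∑ i ∈ Finset.range N, w q.1 i / (α * q.1 + (N * q.2 + i : ℤ)) := ⟨_, rfl⟩
  rw [← hF] at hS
  have hblock : ∀ y : ℤ, ∀ M : ℕ, ∑ x ∈ Finset.Ico (-((N * M : ℕ) : ℤ)) ((N * M : ℕ) : ℤ),
      ((y : ℂ) ^ p)⁻¹ * (w y x / (α * y + x)) = ∑ b ∈ Finset.Ico (-(M : ℤ)) M, F (y, b) := by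
    intro y M
    rw [sum_Ico_blocks _ hN]
    refine Finset.sum_congr rfl fun b _ ↦ ?_
    simp only [hF, Finset.mul_sum]
    refine Finset.sum_congr rfl fun i _ ↦ ?_
    rw [periodic_add_mul (hw y)]
  have hfib : ∀ y : ℤ, HasSum (fun b ↦ F (y, b)) (((y : ℂ) ^ p)⁻¹ * L y) := by
    intro y
    rcases eq_or_ne y 0 with rfl | hy
    · simp only [hF, Int.cast_zero, zero_pow hp, inv_zero, zero_mul]
      exact hasSum_zero
    · have h1 : Summable fun b ↦ F (y, b) := hS.prod_factor y
      have h2 := h1.hasSum.comp tendsto_Ico_neg_atTop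
      have h3 := (hL y hy).const_mul ((y : ℂ) ^ p)⁻¹
      simp_rw [Finset.mul_sum, hblock] at h3
      rw [← tendsto_nhds_unique h2 h3]
      exact h1.hasSum
  have hsum := hS.hasSum.prod_fiberwise hfib
  refine ⟨hsum.summable, ?_⟩
  rw [hsum.tsum_eq]
  simp_rw [hblock, ← Finset.sum_product']
  have h := (tendsto_Ico_neg_mul_atTop hN).prodMk tendsto_Ico_neg_atTop
  rw [prod_atTop_atTop_eq] at h
  have hF' : Tendsto (fun s : Finset (ℤ × ℤ) ↦ ∑ q ∈ s, F q) atTop (𝓝 (∑' q, F q)) := hS.hasSum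
  exact hF'.comp (tendsto_finsetProd_atTop.comp h)

end Summability

/-! ### Fourier series of the Bernoulli functions, including the conditionally convergent case of
order 1 -/

section Fourier

open Filter Topology Complex

lemma re_lt_one_of_norm_eq_one {ζ : ℂ} (hn : ‖ζ‖ = 1) (h1 : ζ ≠ 1) : ζ.re < 1 := by
  refine lt_of_le_of_ne (hn ▸ re_le_norm ζ) fun h ↦ h1 ?_
  have h2 := sq_norm_sub_sq_re ζ
  rw [hn, h] at h2
  have h3 : ζ.im = 0 := by
    rw [← sq_eq_zero_iff]
    linarith
  exact Complex.ext h h3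

/-- Dirichlet's test gives convergence on the unit circle away from 1; Abel's limit theorem
identifies the value with the limit of the logarithm along the radius. -/
lemma tendsto_sum_pow_div {ζ : ℂ} (hn : ‖ζ‖ = 1) (h1 : ζ ≠ 1) :
    Tendsto (fun n : ℕ ↦ ∑ i ∈ Finset.range n, ζ ^ i / i) atTop (𝓝 (-log (1 - ζ))) := by
  have hζ : 0 < ‖ζ - 1‖ := norm_pos_iff.2 (sub_ne_zero.2 h1)
  have hb : ∀ n, ‖∑ i ∈ Finset.range n, ζ ^ (i + 1)‖ ≤ 2 / ‖ζ - 1‖ := by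
    intro n
    simp_rw [pow_succ']
    rw [← Finset.mul_sum, geom_sum_eq h1, norm_mul, hn, one_mul, norm_div]
    gcongr
    refine (norm_sub_le _ _).trans ?_
    rw [norm_pow, hn]
    norm_num
  have hc := Antitone.cauchySeq_series_mul_of_tendsto_zero_of_bounded
    (f := fun n : ℕ ↦ 1 / ((n : ℝ) + 1)) (z := fun i ↦ ζ ^ (i + 1))
    (fun a b hab ↦ Nat.one_div_le_one_div hab) tendsto_one_div_add_atTop_nhds_zero_nat hb
  obtain ⟨l, hl⟩ := cauchySeq_tendsto_of_complete hc
  have hl' : Tendsto (fun n ↦ ∑ i ∈ Finset.range n, ζ ^ (i + 1) / ((i : ℂ) + 1)) atTop (𝓝 l) := by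
    refine hl.congr fun n ↦ Finset.sum_congr rfl fun i _ ↦ ?_
    rw [real_smul]
    push_cast
    ring
  have habel := tendsto_tsum_powerSeries_nhdsWithin_lt hl'
  rw [tendsto_map'_iff] at habel
  have hlog : Tendsto (fun r : ℝ ↦ -log (1 - ζ * r) / r) (𝓝[<] 1) (𝓝 (-log (1 - ζ))) := by
    have hs : 1 - ζ * ((1 : ℝ) : ℂ) ∈ slitPlane := by
      left
      have := re_lt_one_of_norm_eq_one hn h1
      simpa using this
    have hcont : ContinuousAt (fun r : ℝ ↦ -log (1 - ζ * r) / r) 1 := by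
      refine ContinuousAt.div (ContinuousAt.neg (ContinuousAt.clog ?_ hs)) ?_ (by simp)
      · fun_prop
      · fun_prop
    have := hcont.tendsto.mono_left (nhdsWithin_le_nhds (s := Set.Iio 1))
    simpa using this
  have heq : (fun r : ℝ ↦ -log (1 - ζ * r) / r) =ᶠ[𝓝[<] 1]
      ((fun z : ℂ ↦ ∑' n : ℕ, ζ ^ (n + 1) / ((n : ℂ) + 1) * z ^ n) ∘ ofReal) := by
    filter_upwards [Ioo_mem_nhdsLT (show (0 : ℝ) < 1 by norm_num)] with r hr
    have hr0 : (r : ℂ) ≠ 0 := by exact_mod_cast hr.1.ne'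
    have hnr : ‖ζ * r‖ < 1 := by
      rw [norm_mul, hn, one_mul, norm_real, Real.norm_of_nonneg hr.1.le]
      exact hr.2
    have hs := (hasSum_nat_add_iff' 1).2 (hasSum_taylorSeries_neg_log hnr)
    have hs2 := hs.div_const (r : ℂ)
    simp only [Finset.range_one, Finset.sum_singleton, pow_zero, Nat.cast_zero, div_zero,
      sub_zero] at hs2
    rw [Function.comp_apply, ← hs2.tsum_eq]
    refine tsum_congr fun n ↦ ?_
    push_cast
    field_simp
    ring
  have hlim : l = -log (1 - ζ) :=
    tendsto_nhds_unique (habel.congr' heq.symm) hlog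
  rw [← tendsto_add_atTop_iff_nat 1, ← hlim]
  refine hl'.congr fun n ↦ ?_
  rw [Finset.sum_range_succ']
  simp

/-- Factoring out exp(πit) leaves a positive modulus and the argument πt - π/2 in (-π/2, π/2), so
the principal logarithm can be read off. -/
lemma log_one_sub_exp {t : ℝ} (h0 : 0 < t) (h1 : t < 1) :
    log (1 - exp (2 * Real.pi * I * t)) =
      Real.log (2 * Real.sin (Real.pi * t)) + (Real.pi * t - Real.pi / 2 : ℝ) * I := by
  have hpi := Real.pi_pos
  have hsin : 0 < Real.sin (Real.pi * t) :=
    Real.sin_pos_of_pos_of_lt_pi (by positivity) (by nlinarith)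
  have e : 1 - exp (2 * Real.pi * I * t) = ((2 * Real.sin (Real.pi * t) : ℝ) : ℂ) *
      exp ((Real.pi * t - Real.pi / 2 : ℝ) * I) := by
    have e1 : exp ((Real.pi * t - Real.pi / 2 : ℝ) * I) = exp (Real.pi * t * I) * (-I) := by
      push_cast
      rw [sub_mul, exp_sub, exp_pi_div_two_mul_I]
      simp
    have e2 : exp (2 * Real.pi * I * t) = exp (Real.pi * t * I) * exp (Real.pi * t * I) := by
      rw [← exp_add]
      ring_nf
    have e3 : exp (-(Real.pi * t * I)) * exp (Real.pi * t * I) = 1 := by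
      rw [← exp_add]
      simp
    rw [e1, e2]
    push_cast
    rw [sin, neg_mul]
    linear_combination (-e3) + ((exp (-(Real.pi * t * I)) - exp (Real.pi * t * I)) *
      exp (Real.pi * t * I)) * I_sq
  rw [e, log_ofReal_mul (by positivity) (exp_ne_zero _), log_exp]
  · simp only [mul_im, ofReal_re, ofReal_im, I_re, I_im]
    nlinarith
  · simp only [mul_im, ofReal_re, ofReal_im, I_re, I_im]
    nlinarith

lemma log_one_sub_exp_neg {t : ℝ} (h0 : 0 < t) (h1 : t < 1) :
    log (1 - exp (-(2 * Real.pi * I * t))) =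
      Real.log (2 * Real.sin (Real.pi * t)) - (Real.pi * t - Real.pi / 2 : ℝ) * I := by
  have h := log_one_sub_exp (t := 1 - t) (by linarith) (by linarith)
  have e : exp (2 * Real.pi * I * ((1 - t : ℝ) : ℂ)) = exp (-(2 * Real.pi * I * t)) := by
    push_cast
    rw [mul_sub, mul_one, sub_eq_add_neg, exp_add, exp_two_pi_mul_I, one_mul]
  rw [e, mul_sub, mul_one, Real.sin_pi_sub] at h
  rw [h]
  push_cast
  ring

lemma sum_Ico_neg_eq (f : ℤ → ℂ) (h0 : f 0 = 0) (M : ℕ) :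
    ∑ x ∈ Finset.Ico (-(M : ℤ)) M, f x =
      ∑ i ∈ Finset.range M, f i + ∑ i ∈ Finset.range M, f (-i) + f (-M) := by
  induction M with
  | zero => simp [h0]
  | succ n ih =>
    rw [sum_Ico_neg_succ, ih, Finset.sum_range_succ, Finset.sum_range_succ]
    push_cast
    ring

lemma tendsto_sum_Ico_exp_div {t : ℝ} (h0 : 0 ≤ t) (h1 : t < 1) :
    Tendsto (fun M : ℕ ↦ ∑ x ∈ Finset.Ico (-(M : ℤ)) M, exp (2 * Real.pi * I * x * t) / x)
      atTop (𝓝 (-(2 * Real.pi * I) * if t = 0 then 0 else (t - 1 / 2 : ℂ))) := by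
  have hend : Tendsto (fun M : ℕ ↦ exp (2 * Real.pi * I * ((-(M : ℤ) : ℤ) : ℂ) * t) /
      ((-(M : ℤ) : ℤ) : ℂ)) atTop (𝓝 0) := by
    rw [tendsto_zero_iff_norm_tendsto_zero]
    have : Tendsto (fun M : ℕ ↦ ((M : ℝ))⁻¹) atTop (𝓝 0) := tendsto_inv_atTop_nhds_zero_nat
    refine this.congr fun M ↦ ?_
    have e : 2 * Real.pi * I * ((-(M : ℤ) : ℤ) : ℂ) * t = ((2 * Real.pi * (-M) * t : ℝ) : ℂ) * I := by
      push_cast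
      ring
    rw [norm_div, e, norm_exp_ofReal_mul_I]
    simp
  simp_rw [sum_Ico_neg_eq (fun x : ℤ ↦ exp (2 * Real.pi * I * x * t) / x) (by simp)]
  rcases eq_or_ne t 0 with rfl | ht
  · have e : ∀ M : ℕ, ∑ i ∈ Finset.range M, exp (2 * Real.pi * I * ((i : ℤ) : ℂ) * ((0 : ℝ) : ℂ)) /
        ((i : ℤ) : ℂ) + ∑ i ∈ Finset.range M,
        exp (2 * Real.pi * I * ((-(i : ℤ) : ℤ) : ℂ) * ((0 : ℝ) : ℂ)) / ((-(i : ℤ) : ℤ) : ℂ) = 0 := by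
      intro M
      rw [← Finset.sum_add_distrib]
      refine Finset.sum_eq_zero fun i _ ↦ ?_
      push_cast
      simp only [mul_zero, exp_zero]
      rw [div_neg]
      ring
    simp_rw [e, zero_add]
    simpa using hend
  · have ht0 : 0 < t := lt_of_le_of_ne h0 ht.symm
    have hne : exp (2 * Real.pi * I * t) ≠ 1 := by
      intro h
      rw [exp_eq_one_iff] at h
      obtain ⟨n, hn⟩ := h
      have h3 : (2 * Real.pi * I) * (t : ℂ) = (2 * Real.pi * I) * (n : ℂ) := by
        rw [hn]
        ring
      have h4 : (t : ℂ) = (n : ℂ) := mul_left_cancel₀ two_pi_I_ne_zero h3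
      have h5 : t = n := by exact_mod_cast h4
      rw [h5] at ht0 h1
      have h6 : (0 : ℤ) < n := by exact_mod_cast ht0
      have h7 : n < (1 : ℤ) := by exact_mod_cast h1
      lia
    have hne' : exp (-(2 * Real.pi * I * t)) ≠ 1 := by
      rw [exp_neg]
      simpa using hne
    have en : ‖exp (2 * Real.pi * I * t)‖ = 1 := by
      rw [show 2 * Real.pi * I * t = ((2 * Real.pi * t : ℝ) : ℂ) * I by push_cast; ring,
        norm_exp_ofReal_mul_I]
    have en' : ‖exp (-(2 * Real.pi * I * t))‖ = 1 := by
      rw [exp_neg, norm_inv, en, inv_one]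
    have k1 := tendsto_sum_pow_div en hne
    have k2 := (tendsto_sum_pow_div en' hne').neg
    have k3 := (k1.add k2).add hend
    rw [if_neg ht]
    convert k3 using 2
    · congr 2
      · refine Finset.sum_congr rfl fun i _ ↦ ?_
        rw [← exp_nat_mul]
        push_cast
        ring_nf
      · rw [← Finset.sum_neg_distrib]
        refine Finset.sum_congr rfl fun i _ ↦ ?_
        rw [← exp_nat_mul]
        push_cast
        rw [div_neg]
        ring_nf
    · rw [log_one_sub_exp ht0 h1, log_one_sub_exp_neg ht0 h1]
      push_cast
      ring

/-- The term x = 0 is zero by the convention on division. For m = 1 the convergence is only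
conditional, and at integers the terms for x and -x cancel, which matches the value 0 assigned to
`bernFun 1` there. -/
lemma tendsto_sum_expInt_div_pow {N : ℕ} (hN : 0 < N) {m : ℕ} (hm : m ≠ 0) (a : ℤ) :
    Tendsto (fun M : ℕ ↦ ∑ x ∈ Finset.Ico (-((N * M : ℕ) : ℤ)) ((N * M : ℕ) : ℤ),
      expInt N (a * x) / (x : ℂ) ^ m) atTop
      (𝓝 (-(2 * Real.pi * I) ^ m / m ! * (bernFun m ((a : ℝ) / N) : ℂ))) := by
  set t : ℝ := Int.fract ((a : ℝ) / N) with ht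
  have ht0 : 0 ≤ t := Int.fract_nonneg _
  have ht1 : t < 1 := Int.fract_lt_one _
  have he : ∀ x : ℤ, expInt N (a * x) = exp (2 * Real.pi * I * x * t) := by
    intro x
    rw [expInt, exp_eq_exp_iff_exists_int]
    refine ⟨⌊(a : ℝ) / N⌋ * x, ?_⟩
    have : (t : ℂ) = (a : ℂ) / N - (⌊(a : ℝ) / N⌋ : ℂ) := by
      rw [ht, Int.fract]
      push_cast
      rfl
    rw [this]
    push_cast
    ring
  simp_rw [he]
  rcases eq_or_ne m 1 with rfl | hm1
  · have h := (tendsto_sum_Ico_exp_div ht0 ht1).comp (tendsto_id.const_mul_atTop' hN)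
    simp only [pow_one, Nat.factorial_one, Nat.cast_one, div_one]
    convert! h using 2
    rw [bernFun, ← ht]
    by_cases h0 : t = 0
    · simp [h0]
    · simp [h0, bernoulliFun_one]
  · have h := hasSum_one_div_pow_mul_fourier_mul_bernoulliFun (k := m) (by lia) ⟨ht0, ht1.le⟩
    have h' : Tendsto (fun s : Finset ℤ ↦ ∑ x ∈ s, 1 / (x : ℂ) ^ m *
      fourier x (t : UnitAddCircle)) atTop _ := h
    convert! h'.comp (tendsto_Ico_neg_mul_atTop hN) using 2
    · refine Finset.sum_congr rfl fun x _ ↦ ?_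
      rw [fourier_coe_apply, div_mul_eq_mul_div, one_mul]
      push_cast
      rw [div_one]
    · rw [bernFun, ← ht]
      simp [hm1]

end Fourier

/-! ### The weight and its partial Fourier transforms -/

section Weight

open Filter Topology Complex

lemma bernFun_neg {m : ℕ} (x : ℝ) : bernFun m (-x) = (-1) ^ m * bernFun m x := by
  rw [bernFun, bernFun]
  by_cases hx : Int.fract x = 0
  · have hx' : Int.fract (-x) = 0 := by rwa [Int.fract_neg_eq_zero]
    rw [hx, hx']
    by_cases hm : m = 1
    · simp [hm]
    · have h1 := bernoulliFun_eval_one_sub (k := m) (x := 0)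
      rw [sub_zero, bernoulliFun_endpoints_eq_of_ne_one hm] at h1
      simpa [hm] using h1
  · have hx' : Int.fract (-x) ≠ 0 := by rwa [Ne, Int.fract_neg_eq_zero]
    simp [hx, hx']
    rw [Int.fract_neg hx, bernoulliFun_eval_one_sub]

lemma sum_range_ite_dvd {f : ℤ → ℂ} {N : ℕ} (hN : 0 < N) (hf : ∀ x, f (x + N) = f x) (s : ℤ) :
    ∑ i ∈ Finset.range N, (if (N : ℤ) ∣ i + s then f i else 0) = f (-s) := by
  have hg : ∀ x : ℤ, (if (N : ℤ) ∣ x + N + s then f (x + N) else 0) =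
      if (N : ℤ) ∣ x + s then f x else 0 := by
    intro x
    rw [hf]
    exact if_congr (by rw [add_right_comm, dvd_add_left (dvd_refl _)]) rfl rfl
  rw [← sum_range_shift (f := fun x ↦ if (N : ℤ) ∣ x + s then f x else 0) hg (-s),
    Finset.sum_eq_single 0]
  · simp
  · intro i hi hi0
    have : ¬ (N : ℤ) ∣ i := by
      intro h
      have := Nat.le_of_dvd (Nat.pos_of_ne_zero hi0) (by exact_mod_cast h)
      exact absurd (Finset.mem_range.1 hi) (by lia)
    simp [this]
  · intro h
    exact absurd (Finset.mem_range.2 hN) h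

/-- Solves jc + dn + m ≡ 0 mod ck. Modulo c it forces n ≡ -am, because ad ≡ 1. Writing n = -am + ct
and using ad - bc = 1, the left side becomes c(j + dt - bm), so j ≡ bm - dt mod k. -/
lemma sum_range_ite_dvd_linear {F H : ℤ → ℂ} {c k : ℕ} (hc : 0 < c) (hk : 0 < k)
    (hF : ∀ x, F (x + (c * k : ℕ)) = F x) (hH : ∀ x, H (x + k) = H x) {a b d : ℤ}
    (hdet : a * d - b * c = 1) (m : ℤ) :
    ∑ n ∈ Finset.range (c * k), ∑ j ∈ Finset.range k,
      (if ((c * k : ℕ) : ℤ) ∣ j * c + d * n + m then F n * H j else 0) =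
      ∑ t ∈ Finset.range k, F (-(a * m) + c * t) * H (b * m - d * t) := by
  have hc' : (c : ℤ) ≠ 0 := by exact_mod_cast hc.ne'
  have hper : ∀ x : ℤ, (∑ j ∈ Finset.range k,
      if ((c * k : ℕ) : ℤ) ∣ j * c + d * (x + (c * k : ℕ)) + m then F (x + (c * k : ℕ)) * H j else 0) =
      ∑ j ∈ Finset.range k, if ((c * k : ℕ) : ℤ) ∣ j * c + d * x + m then F x * H j else 0 := by
    intro x
    refine Finset.sum_congr rfl fun j _ ↦ ?_
    rw [hF]
    refine if_congr ?_ rfl rfl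
    rw [show j * c + d * (x + (c * k : ℕ)) + m =
      j * c + d * x + m + ((c * k : ℕ) : ℤ) * d by ring, dvd_add_left (dvd_mul_right _ _)]
  rw [← sum_range_shift (f := fun x ↦ ∑ j ∈ Finset.range k,
    if ((c * k : ℕ) : ℤ) ∣ j * c + d * x + m then F x * H j else 0) hper (-(a * m))]
  symm
  refine Finset.sum_of_injOn (fun t ↦ c * t) ?_ ?_ ?_ ?_
  · intro x _ y _ h
    exact Nat.eq_of_mul_eq_mul_left hc h
  · intro t ht
    simp only [Finset.coe_range, Set.mem_Iio] at ht ⊢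
    exact Nat.mul_lt_mul_of_pos_left ht hc
  · intro i hi hi'
    refine Finset.sum_eq_zero fun j _ ↦ if_neg fun h ↦ hi' ?_
    have h1 : (c : ℤ) ∣ j * c + d * (i + -(a * m)) + m :=
      dvd_trans (by push_cast; exact dvd_mul_right _ _) h
    have h2 : (c : ℤ) ∣ i := by
      have h3 : (i : ℤ) = a * (j * c + d * (i + -(a * m)) + m) +
          c * (-a * j - b * i + a * b * m) := by
        linear_combination (i - a * m) * (-hdet)
      rw [h3]
      exact dvd_add (Dvd.dvd.mul_left h1 _) (dvd_mul_right _ _)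
    obtain ⟨t, rfl⟩ : c ∣ i := by exact_mod_cast h2
    refine ⟨t, ?_, rfl⟩
    simp only [Finset.coe_range, Set.mem_Iio, Finset.mem_range] at hi ⊢
    exact lt_of_mul_lt_mul_left hi (Nat.zero_le c)
  · intro t _
    have h1 := sum_range_ite_dvd hk hH (d * t - b * m)
    rw [neg_sub] at h1
    rw [← h1, Finset.mul_sum]
    refine Finset.sum_congr rfl fun j _ ↦ ?_
    have h2 : (j : ℤ) * c + d * ((c * t : ℕ) + -(a * m)) + m = c * (j + (d * t - b * m)) := by
      push_cast
      linear_combination (-m) * hdet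
    rw [mul_ite, mul_zero]
    refine if_congr ?_ ?_ rfl
    · rw [h2]
      push_cast
      rw [mul_dvd_mul_iff_left hc']
    · push_cast
      rw [add_comm (-(a * m))]

variable {k : ℕ}

lemma isPrimitive_star {ψ : DirichletCharacter ℂ k} (hψ : ψ.IsPrimitive) :
    DirichletCharacter.IsPrimitive (star ψ) := by
  rw [MulChar.star_eq_inv, DirichletCharacter.isPrimitive_def, DirichletCharacter.conductor_inv]
  exact hψ

lemma char_mul_star_self {ψ : DirichletCharacter ℂ k} {u : ZMod k} (hu : IsUnit u) :
    ψ u * star ψ u = 1 := by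
  rw [MulChar.star_eq_inv, ← MulChar.mul_apply, mul_inv_cancel, MulChar.one_apply hu]

/-- The doubly periodic weight whose two partial Fourier transforms are both products of
characters. -/
noncomputable def weight (ψ : DirichletCharacter ℂ k) (c : ℕ) (d x y : ℤ) : ℂ :=
  ∑ n ∈ Finset.range (c * k), ∑ j ∈ Finset.range k,
    ((-1 : ℂ) ^ n * ψ (n : ZMod k) * star ψ (j : ZMod k)) *
      (expInt (c * k) (-n * x) * expInt (c * k) ((j * c + d * n) * y))

lemma norm_weight_le (ψ : DirichletCharacter ℂ k) (c : ℕ) (d x y : ℤ) :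
    ‖weight ψ c d x y‖ ≤ ∑ _n ∈ Finset.range (c * k), ∑ _j ∈ Finset.range k, (1 : ℝ) := by
  refine norm_sum_le_of_le _ fun n _ ↦ norm_sum_le_of_le _ fun j _ ↦ ?_
  simp only [norm_mul, norm_pow, norm_neg, norm_one, one_pow, norm_expInt, one_mul, mul_one]
  have h1 := DirichletCharacter.norm_le_one ψ (n : ZMod k)
  have h2 := DirichletCharacter.norm_le_one (star ψ) (j : ZMod k)
  exact mul_le_one₀ h1 (norm_nonneg _) h2

lemma neg_one_zpow_add_of_even {N : ℤ} (hN : Even N) (x : ℤ) :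
    (-1 : ℂ) ^ (x + N) = (-1) ^ x := by
  rw [zpow_add₀ (by norm_num), hN.neg_one_zpow, mul_one]

lemma char_add_mul (ψ : DirichletCharacter ℂ k) (x : ℤ) (c : ℕ) :
    ψ ((x + (c * k : ℕ) : ℤ) : ZMod k) = ψ (x : ZMod k) := by
  push_cast
  simp

variable [NeZero k]

lemma sum_range_eq_sum_zmod (f : ZMod k → ℂ) :
    ∑ j ∈ Finset.range k, f (j : ZMod k) = ∑ a : ZMod k, f a := by
  refine Finset.sum_nbij' (fun j ↦ (j : ZMod k)) (fun a ↦ a.val) ?_ ?_ ?_ ?_ ?_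
  · simp
  · intro a _
    simpa using ZMod.val_lt a
  · intro j hj
    exact ZMod.val_cast_of_lt (Finset.mem_range.1 hj)
  · intro a _
    exact ZMod.natCast_zmod_val a
  · simp

lemma sum_char_mul_expInt {ψ : DirichletCharacter ℂ k} (hψ : ψ.IsPrimitive) (y : ℤ) :
    ∑ j ∈ Finset.range k, ψ (j : ZMod k) * expInt k (y * j) = star ψ (y : ZMod k) * gauss ψ := by
  rw [gauss, MulChar.star_eq_inv, ← gaussSum_mulShift_of_isPrimitive _ hψ, gaussSum,
    ← sum_range_eq_sum_zmod]
  refine Finset.sum_congr rfl fun j _ ↦ ?_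
  rw [AddChar.mulShift_apply, expInt, ← ZMod.stdAddChar_coe]
  push_cast
  rfl

lemma weight_add_left {ψ : DirichletCharacter ℂ k} {c : ℕ} (hc : 0 < c) (d x y : ℤ) :
    weight ψ c d (x + (c * k : ℕ)) y = weight ψ c d x y := by
  have hN : 0 < c * k := Nat.mul_pos hc (NeZero.pos k)
  simp_rw [weight, mul_add, expInt_add, mul_comm _ ((c * k : ℕ) : ℤ), expInt_mul_self hN, mul_one]

lemma weight_add_right {ψ : DirichletCharacter ℂ k} {c : ℕ} (hc : 0 < c) (d x y : ℤ) :
    weight ψ c d x (y + (c * k : ℕ)) = weight ψ c d x y := by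
  have hN : 0 < c * k := Nat.mul_pos hc (NeZero.pos k)
  simp_rw [weight, mul_add, expInt_add, mul_comm _ ((c * k : ℕ) : ℤ), expInt_mul_self hN, mul_one]

/-- Orthogonality in x selects n ≡ -m, and the free sum over j is a Gauss sum, separable because ψ
is primitive. Evenness of c makes (-1)^n a function of n mod ck. -/
lemma sum_weight_mul_expInt_left {ψ : DirichletCharacter ℂ k} (hψ : ψ.IsPrimitive) {c : ℕ}
    (hc : 0 < c) (hc2 : Even c) (d m y : ℤ) :
    ∑ i ∈ Finset.range (c * k), weight ψ c d i y * expInt (c * k) (-m * i) =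
      (c * k : ℕ) * (ψ (-1) * ((-1) ^ m * ψ (m : ZMod k) * ψ (y : ZMod k) * gauss (star ψ) *
        expInt (c * k) (-(d * m * y)))) := by
  have hN : 0 < c * k := Nat.mul_pos hc (NeZero.pos k)
  have hNe : Even ((c * k : ℕ) : ℤ) := by
    push_cast
    exact (hc2.natCast (α := ℤ)).mul_right _
  set F : ℤ → ℂ := fun n ↦ (-1 : ℂ) ^ n * ψ (n : ZMod k) * expInt (c * k) (d * n * y) with hF
  have hFper : ∀ x, F (x + (c * k : ℕ)) = F x := by
    intro x
    simp only [hF]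
    rw [neg_one_zpow_add_of_even hNe, char_add_mul,
      show d * (x + (c * k : ℕ)) * y = d * x * y + (c * k : ℕ) * (d * y) by ring, expInt_add,
      expInt_mul_self hN, mul_one]
  have hg := sum_char_mul_expInt (isPrimitive_star hψ) y
  rw [star_star] at hg
  simp_rw [weight, Finset.sum_mul]
  rw [Finset.sum_comm]
  calc _ = ∑ n ∈ Finset.range (c * k), (if ((c * k : ℕ) : ℤ) ∣ n + m then F n else 0) *
        ((c * k : ℕ) * ∑ j ∈ Finset.range k, star ψ (j : ZMod k) * expInt k (y * j)) := by
        refine Finset.sum_congr rfl fun n _ ↦ ?_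
        rw [Finset.sum_comm, Finset.mul_sum, Finset.mul_sum]
        refine Finset.sum_congr rfl fun j _ ↦ ?_
        have hs := sum_expInt hN (-(n + m))
        simp only [dvd_neg] at hs
        have h1 : (if ((c * k : ℕ) : ℤ) ∣ n + m then F n else 0) * (c * k : ℕ) =
            F n * ∑ i ∈ Finset.range (c * k), expInt (c * k) (-(n + m) * i) := by
          rw [hs]
          split_ifs <;> simp
        rw [← mul_assoc, h1, Finset.mul_sum, Finset.sum_mul]
        refine Finset.sum_congr rfl fun i _ ↦ ?_
        have e1 : expInt (c * k) (-(n + m) * i) =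
            expInt (c * k) (-n * i) * expInt (c * k) (-m * i) := by
          rw [← expInt_add]
          ring_nf
        have e2 : expInt (c * k) ((j * c + d * n) * y) =
            expInt k (y * j) * expInt (c * k) (d * n * y) := by
          rw [← expInt_mul_mul hc (y * j), ← expInt_add]
          ring_nf
        rw [e1, e2, hF]
        simp only [zpow_natCast, Int.cast_natCast]
        ring
    _ = _ := by
        rw [← Finset.sum_mul, sum_range_ite_dvd hN hFper, hg]
        simp only [hF]
        have : ψ ((-m : ℤ) : ZMod k) = ψ (-1) * ψ (m : ZMod k) := by
          rw [← map_mul]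
          simp
        rw [this, zpow_neg, ← inv_zpow, inv_neg, inv_one]
        ring_nf

/-- Orthogonality in y imposes the linear congruence on (n, j) solved by `sum_range_ite_dvd_linear`.
-/
lemma sum_weight_mul_expInt_right (ψ : DirichletCharacter ℂ k) {c : ℕ}
    (hc : 0 < c) (hc2 : Even c) {a b d : ℤ} (hdet : a * d - b * c = 1) (m x : ℤ) :
    ∑ i ∈ Finset.range (c * k), weight ψ c d x i * expInt (c * k) (m * i) =
      (c * k : ℕ) * ((-1) ^ m * expInt (c * k) (a * m * x) * ∑ t ∈ Finset.range k,
        ψ ((-(a * m) + c * t : ℤ) : ZMod k) * star ψ ((b * m - d * t : ℤ) : ZMod k) *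
          expInt k (-x * t)) := by
  have hk : 0 < k := NeZero.pos k
  have hN : 0 < c * k := Nat.mul_pos hc hk
  have hNe : Even ((c * k : ℕ) : ℤ) := by
    push_cast
    exact (hc2.natCast (α := ℤ)).mul_right _
  set F : ℤ → ℂ := fun n ↦ (-1 : ℂ) ^ n * ψ (n : ZMod k) * expInt (c * k) (-n * x) with hF
  set H : ℤ → ℂ := fun j ↦ star ψ (j : ZMod k) with hH
  have hFper : ∀ x, F (x + (c * k : ℕ)) = F x := by
    intro n
    simp only [hF]
    rw [neg_one_zpow_add_of_even hNe, char_add_mul,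
      show -(n + (c * k : ℕ)) * x = -n * x + (c * k : ℕ) * (-x) by ring, expInt_add,
      expInt_mul_self hN, mul_one]
  have hHper : ∀ x, H (x + k) = H x := by
    intro x
    simp only [hH]
    push_cast
    simp
  have hodd : Odd a := by
    by_contra h
    rw [Int.not_odd_iff_even] at h
    have h2 : Even (a * d - b * c) := (h.mul_right d).sub ((hc2.natCast (α := ℤ)).mul_left b)
    rw [hdet] at h2
    exact absurd h2 (by decide)
  have hmain := sum_range_ite_dvd_linear hc hk hFper hHper hdet m
  simp_rw [weight, Finset.sum_mul]
  rw [Finset.sum_comm]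
  calc _ = (c * k : ℕ) * ∑ n ∈ Finset.range (c * k), ∑ j ∈ Finset.range k,
      (if ((c * k : ℕ) : ℤ) ∣ j * c + d * n + m then F n * H j else 0) := by
        rw [Finset.mul_sum]
        refine Finset.sum_congr rfl fun n _ ↦ ?_
        rw [Finset.sum_comm, Finset.mul_sum]
        refine Finset.sum_congr rfl fun j _ ↦ ?_
        have hs := sum_expInt hN (j * c + d * n + m)
        have h1 : ((c * k : ℕ) : ℂ) *
            (if ((c * k : ℕ) : ℤ) ∣ j * c + d * n + m then F n * H j else 0) =
            F n * H j * ∑ i ∈ Finset.range (c * k), expInt (c * k) ((j * c + d * n + m) * i) := by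
          rw [hs]
          split_ifs
          · ring
          · simp
        rw [h1, Finset.mul_sum]
        refine Finset.sum_congr rfl fun i _ ↦ ?_
        rw [add_mul _ m, expInt_add]
        simp only [hF, hH, zpow_natCast, Int.cast_natCast]
        ring
    _ = _ := by
        rw [hmain, mul_assoc ((-1 : ℂ) ^ m)]
        congr 1
        rw [Finset.mul_sum, Finset.mul_sum]
        refine Finset.sum_congr rfl fun t _ ↦ ?_
        simp only [hF, hH]
        -- As c is even, ct does not affect the sign; ad - bc = 1 then makes a odd, so the sign is
        -- that of m.
        have e1 : (-1 : ℂ) ^ (-(a * m) + c * t) = (-1) ^ m := by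
          rw [neg_one_zpow_add_of_even ((hc2.natCast (α := ℤ)).mul_right _), zpow_neg, zpow_mul,
            hodd.neg_one_zpow, ← inv_zpow, inv_neg, inv_one]
        have e2 : expInt (c * k) (-(-(a * m) + c * t) * x) =
            expInt (c * k) (a * m * x) * expInt k (-x * t) := by
          rw [← expInt_mul_mul hc (-x * t), ← expInt_add]
          ring_nf
        rw [e1, e2]
        ring

/-- With b ≡ c ≡ 0 the arguments -am + ct and bm - dt reduce to -am and -dt, so t occurs in only one
character and the sum over t is a Gauss sum. -/
lemma weight_right_transform_of_bc {χ : DirichletCharacter ℂ k} (hχ : χ.IsPrimitive) {c : ℕ}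
    (hc : 0 < c) (hc2 : Even c) {a b d : ℤ} (hdet : a * d - b * c = 1)
    (hb : (b : ZMod k) = 0) (hck : (c : ZMod k) = 0) (m x : ℤ) :
    ∑ i ∈ Finset.range (c * k), weight χ c d x i * expInt (c * k) (m * i) =
      (c * k : ℕ) * (χ (-1) * χ (a : ZMod k) * star χ (d : ZMod k) *
        ((-1) ^ m * χ (m : ZMod k) * χ (x : ZMod k) * gauss (star χ) *
          expInt (c * k) (a * m * x))) := by
  have hg := sum_char_mul_expInt (isPrimitive_star hχ) (-x)
  rw [star_star] at hg
  rw [sum_weight_mul_expInt_right χ hc hc2 hdet]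
  have h1 : ∀ t : ℕ, χ ((-(a * m) + c * t : ℤ) : ZMod k) * star χ ((b * m - d * t : ℤ) : ZMod k) *
      expInt k (-x * t) = χ (a : ZMod k) * χ (m : ZMod k) * star χ (d : ZMod k) *
        (χ (-1) * star χ (-1)) * (star χ (t : ZMod k) * expInt k (-x * t)) := by
    intro t
    have e1 : ((-(a * m) + c * t : ℤ) : ZMod k) = -1 * (a * m) := by
      push_cast
      rw [hck]
      ring
    have e2 : ((b * m - d * t : ℤ) : ZMod k) = -1 * (d * t) := by
      push_cast
      rw [hb]
      ring
    rw [e1, e2]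
    simp only [map_mul]
    ring
  simp_rw [h1]
  rw [← Finset.mul_sum, hg, char_mul_star_self isUnit_neg_one]
  have : χ ((-x : ℤ) : ZMod k) = χ (-1) * χ (x : ZMod k) := by
    rw [← map_mul]
    simp
  rw [this]
  ring

/-- With a ≡ d ≡ 0 the arguments reduce to ct and bm: the roles of the two characters are exchanged.
Starting from χ̄ therefore again produces χ(m) χ(x). -/
lemma weight_right_transform_of_ad {χ : DirichletCharacter ℂ k} (hχ : χ.IsPrimitive) {c : ℕ}
    (hc : 0 < c) (hc2 : Even c) {a b d : ℤ} (hdet : a * d - b * c = 1)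
    (ha : (a : ZMod k) = 0) (hd : (d : ZMod k) = 0) (m x : ℤ) :
    ∑ i ∈ Finset.range (c * k), weight (star χ) c d x i * expInt (c * k) (m * i) =
      (c * k : ℕ) * (χ (-1) * χ (b : ZMod k) * star χ (c : ZMod k) *
        ((-1) ^ m * χ (m : ZMod k) * χ (x : ZMod k) * gauss (star χ) *
          expInt (c * k) (a * m * x))) := by
  have hg := sum_char_mul_expInt (isPrimitive_star hχ) (-x)
  rw [star_star] at hg
  rw [sum_weight_mul_expInt_right (star χ) hc hc2 hdet, star_star]
  have h1 : ∀ t : ℕ, star χ ((-(a * m) + c * t : ℤ) : ZMod k) * χ ((b * m - d * t : ℤ) : ZMod k) *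
      expInt k (-x * t) = star χ (c : ZMod k) * χ (b : ZMod k) * χ (m : ZMod k) *
        (star χ (t : ZMod k) * expInt k (-x * t)) := by
    intro t
    have e1 : ((-(a * m) + c * t : ℤ) : ZMod k) = c * t := by
      push_cast
      rw [ha]
      ring
    have e2 : ((b * m - d * t : ℤ) : ZMod k) = b * m := by
      push_cast
      rw [hd]
      ring
    rw [e1, e2]
    simp only [map_mul]
    ring
  simp_rw [h1]
  rw [← Finset.mul_sum, hg]
  have : χ ((-x : ℤ) : ZMod k) = χ (-1) * χ (x : ZMod k) := by
    rw [← map_mul]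
    simp
  rw [this]
  ring

/-- Fourier inversion on ℤ/N; used to show that the weight vanishes on both coordinate axes. -/
lemma eq_zero_of_transform_eq_zero {N : ℕ} (hN : 0 < N) {f : ℤ → ℂ} (hf : ∀ x, f (x + N) = f x)
    (h : ∀ m : ℤ, ∑ i ∈ Finset.range N, f i * expInt N (m * i) = 0) (y : ℤ) : f y = 0 := by
  have h1 : ∑ m ∈ Finset.range N, ∑ i ∈ Finset.range N,
      f i * expInt N (m * i) * expInt N (m * -y) = 0 := by
    refine Finset.sum_eq_zero fun m _ ↦ ?_
    rw [← Finset.sum_mul, h, zero_mul]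
  rw [Finset.sum_comm] at h1
  have h2 : ∀ i : ℕ, ∑ m ∈ Finset.range N, f i * expInt N (m * i) * expInt N (m * -y) =
      (if (N : ℤ) ∣ i + -y then f i else 0) * N := by
    intro i
    have hs := sum_expInt hN (i + -y)
    simp_rw [mul_assoc, ← expInt_add, ← mul_add, ← Finset.mul_sum]
    simp_rw [mul_comm _ ((i : ℤ) + -y)]
    rw [hs]
    split_ifs <;> simp
  simp_rw [h2] at h1
  rw [← Finset.sum_mul, sum_range_ite_dvd hN hf, neg_neg] at h1
  have hN' : (N : ℂ) ≠ 0 := by exact_mod_cast hN.ne'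
  exact (mul_eq_zero.1 h1).resolve_right hN'

end Weight

/-! ### Partial fractions, and box sums evaluated as `H₁` -/

section Transformation

open Filter Topology Complex

/-- This is (αy)^p - x^p = (αy - x) ∑ (αy)^i x^(p-1-i), divided by x^p y^p (αy - x), with m = i + 1.
-/
lemma partial_fraction_identity {α x y : ℂ} (hx : x ≠ 0) (hy : y ≠ 0) (h : α * y - x ≠ 0) {p : ℕ}
    (hp : p ≠ 0) :
    α ^ p * (x ^ p)⁻¹ / (α * y - x) - (y ^ p)⁻¹ / (α * y - x) =
      ∑ m ∈ Finset.Icc 1 p, α ^ (m - 1) / (x ^ m * y ^ (p + 1 - m)) := by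
  have hg := geom_sum₂_mul (α * y) x p
  have e : ∑ m ∈ Finset.Icc 1 p, α ^ (m - 1) / (x ^ m * y ^ (p + 1 - m)) =
      (∑ i ∈ Finset.range p, (α * y) ^ i * x ^ (p - 1 - i)) / (x ^ p * y ^ p) := by
    rw [Finset.sum_div]
    refine Finset.sum_nbij' (fun m ↦ m - 1) (fun i ↦ i + 1) ?_ ?_ ?_ ?_ ?_
    · intro m hm
      simp only [Finset.mem_Icc, Finset.mem_range] at *
      lia
    · intro m hm
      simp only [Finset.mem_Icc, Finset.mem_range] at *
      lia
    · intro m hm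
      simp only [Finset.mem_Icc] at *
      lia
    · intro m hm
      simp
    · intro m hm
      simp only [Finset.mem_Icc] at hm
      obtain ⟨i, rfl⟩ : ∃ i, m = i + 1 := ⟨m - 1, by lia⟩
      obtain ⟨l, rfl⟩ : ∃ l, p = i + 1 + l := ⟨p - (i + 1), by lia⟩
      have e1 : i + 1 + l + 1 - (i + 1) = l + 1 := by lia
      have e2 : i + 1 + l - 1 - (i + 1 - 1) = l := by lia
      rw [e1, e2, Nat.add_sub_cancel]
      field_simp
      ring
  rw [e, ← sub_div, div_eq_div_iff h (by positivity), hg, mul_pow]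
  field_simp

variable {k : ℕ}

/-- As p is odd, y^(-p) L(y) is even, so the sum over ℤ is twice the sum over y ≥ 1; that 2 is
exactly the factor 1 + exp(πi(1 - p)) in `H₁`. -/
lemma tsum_int_eq_mul_H₁ (θ : DirichletCharacter ℂ k) {p : ℕ} (hp : Odd p) {τ C : ℂ} {L : ℤ → ℂ}
    (hL : ∀ n : ℕ+, L (n : ℕ) = C * (θ ((n : ℕ) : ZMod k) * ∑' m : ℕ+, (-1 : ℂ) ^ (m : ℕ) *
      θ ((m : ℕ) : ZMod k) * exp (2 * Real.pi * I * (m : ℕ) * (n : ℕ) * τ / k)))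
    (hodd : ∀ y ≠ 0, L (-y) = -L y) (hs : Summable fun y : ℤ ↦ ((y : ℂ) ^ p)⁻¹ * L y) :
    ∑' y : ℤ, ((y : ℂ) ^ p)⁻¹ * L y = C * H₁ τ (1 - p) θ := by
  have hp0 : p ≠ 0 := by
    rintro rfl
    exact absurd hp (by decide)
  have heven : Function.Even fun y : ℤ ↦ ((y : ℂ) ^ p)⁻¹ * L y := by
    intro y
    rcases eq_or_ne y 0 with rfl | hy
    · simp
    · simp only
      rw [hodd y hy]
      push_cast
      rw [hp.neg_pow, inv_neg, neg_mul_neg]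
  rw [tsum_int_eq_zero_add_two_mul_tsum_pnat heven hs, H₁, A₁]
  have e : 1 + exp (Real.pi * I * (1 - p)) = 2 := by
    obtain ⟨r, rfl⟩ := hp
    have : (Real.pi : ℂ) * I * (1 - ((2 * r + 1 : ℕ) : ℂ)) = ((-r : ℤ) : ℂ) * (2 * Real.pi * I) := by
      push_cast
      ring
    rw [this, exp_int_mul_two_pi_mul_I]
    norm_num
  rw [e]
  simp only [Int.cast_zero, zero_pow hp0, inv_zero, zero_mul, zero_add, nsmul_eq_mul,
    Nat.cast_ofNat]
  rw [mul_left_comm, ← tsum_mul_left (a := C)]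
  congr 1
  refine tsum_congr fun n ↦ ?_
  rw [hL, mul_left_comm]
  congr 1
  rw [← mul_assoc, ← tsum_mul_left]
  refine tsum_congr fun m ↦ ?_
  have e2 : ((n : ℕ) : ℂ) ^ ((1 - p : ℂ) - 1) = (((n : ℕ) : ℂ) ^ p)⁻¹ := by
    rw [show (1 - p : ℂ) - 1 = -(p : ℂ) by ring, cpow_neg, cpow_natCast]
  rw [e2]
  push_cast
  ring

lemma tendsto_box_sum_of_im_pos [NeZero k] {c : ℕ} (hc : 0 < c) {β : ℂ} (hβ : 0 < β.im) {p : ℕ}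
    (hp : Odd p) {w : ℤ → ℤ → ℂ} {C : ℝ} (hC : ∀ y x, ‖w y x‖ ≤ C)
    (hw : ∀ y x, w y (x + (c * k : ℕ)) = w y x)
    (h0 : ∀ y, ∑ i ∈ Finset.range (c * k), w y i = 0) {K : ℂ} {θ : DirichletCharacter ℂ k} {e : ℤ}
    (htr : ∀ m y : ℤ, ∑ i ∈ Finset.range (c * k), w y i * expInt (c * k) (m * i) =
      (c * k : ℕ) * (K * ((-1) ^ m * θ (m : ZMod k) * θ (y : ZMod k) * expInt (c * k) (e * m * y)))) :
    Tendsto (fun M : ℕ ↦ ∑ y ∈ Finset.Ico (-((c * k * M : ℕ) : ℤ)) ((c * k * M : ℕ) : ℤ),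
      ∑ x ∈ Finset.Ico (-((c * k * M : ℕ) : ℤ)) ((c * k * M : ℕ) : ℤ),
        ((y : ℂ) ^ p)⁻¹ * (w y x / (β * y + x))) atTop
      (𝓝 (-2 * Real.pi * I * K * H₁ ((e + β) / c) (1 - p) θ)) := by
  have hk : 0 < k := NeZero.pos k
  have hN : 0 < c * k := Nat.mul_pos hc hk
  have hN' : ((c * k : ℕ) : ℂ) ≠ 0 := by exact_mod_cast hN.ne'
  have hc' : (c : ℂ) ≠ 0 := by exact_mod_cast hc.ne'
  have hk' : (k : ℂ) ≠ 0 := by exact_mod_cast hk.ne'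
  have hp0 : p ≠ 0 := by
    rintro rfl
    exact absurd hp (by decide)
  set V : ℤ → ℂ := fun y ↦ -2 * Real.pi * I * K * (θ (y : ZMod k) * ∑' m : ℕ+, (-1 : ℂ) ^ (m : ℕ) *
      θ ((m : ℕ) : ZMod k) * exp (2 * Real.pi * I * (m : ℕ) * y * ((e + β) / c) / k)) with hV
  -- The odd extension of V. For y < 0 the point βy lies in the lower half plane, where the
  -- cotangent expansion has the opposite sign and frequency -m; since θ(-m)θ(y) = θ(m)θ(-y), the
  -- limit is -V(-y). The value at 0 is irrelevant.
  set L : ℤ → ℂ := fun y ↦ if 0 < y then V y else -V (-y) with hL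
  have hexp : ∀ (m : ℕ+) (y : ℤ), expInt (c * k) (e * m * y) *
      exp (2 * Real.pi * I * (m : ℕ) * (β * y) / (c * k : ℕ)) =
      exp (2 * Real.pi * I * (m : ℕ) * y * ((e + β) / c) / k) := by
    intro m y
    rw [expInt, ← exp_add]
    congr 1
    push_cast
    field_simp
  have hlim : ∀ y ≠ 0, Tendsto (fun M : ℕ ↦
      ∑ x ∈ Finset.Ico (-((c * k * M : ℕ) : ℤ)) ((c * k * M : ℕ) : ℤ),
      w y x / (β * y + x)) atTop (𝓝 (L y)) := by
    intro y hy
    rcases lt_or_gt_of_ne hy with hneg | hpos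
    · have hu : (β * y).im < 0 := by
        have : (y : ℝ) < 0 := by exact_mod_cast hneg
        simp only [mul_im, intCast_re, intCast_im, mul_zero, zero_add]
        nlinarith
      convert tendsto_sum_div_add_of_im_neg hN (hw y) (h0 y) hu using 2
      simp only [hL, if_neg hneg.not_gt, hV]
      simp_rw [← tsum_mul_left]
      rw [← tsum_neg]
      refine tsum_congr fun m ↦ ?_
      have htr' := htr (-m) y
      have h3 := hexp m (-y)
      rw [show e * m * -y = e * -m * y by ring] at h3
      have h4 : exp (-(2 * Real.pi * I * (m : ℕ) * (β * y) / (c * k : ℕ))) =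
          exp (2 * Real.pi * I * (m : ℕ) * (β * ((-y : ℤ) : ℂ)) / (c * k : ℕ)) := by
        push_cast
        ring_nf
      have h5 : θ ((-(m : ℕ) : ℤ) : ZMod k) * θ (y : ZMod k) =
          θ ((-y : ℤ) : ZMod k) * θ ((m : ℕ) : ZMod k) := by
        rw [← map_mul, ← map_mul]
        push_cast
        ring_nf
      rw [htr', h4, ← h3, zpow_neg, ← inv_zpow, inv_neg, inv_one, zpow_natCast,
        mul_assoc ((-1 : ℂ) ^ (m : ℕ)) (θ ((-(m : ℕ) : ℤ) : ZMod k)), h5]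
      field_simp
    · have hu : 0 < (β * y).im := by
        have : 0 < (y : ℝ) := by exact_mod_cast hpos
        simp only [mul_im, intCast_re, intCast_im, mul_zero, zero_add]
        positivity
      convert tendsto_sum_div_add_of_im_pos hN (hw y) (h0 y) hu using 2
      simp only [hL, if_pos hpos, hV]
      simp_rw [← tsum_mul_left]
      refine tsum_congr fun m ↦ ?_
      rw [htr, ← hexp, zpow_natCast]
      push_cast
      field_simp
  obtain ⟨hs, ht⟩ := tendsto_box_sum hN hβ.ne' hp0 hC hw h0 hlim
  rwa [tsum_int_eq_mul_H₁ θ hp (C := -2 * Real.pi * I * K) (τ := (e + β) / c) ?_ ?_ hs] at ht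
  · intro n
    have : (0 : ℤ) < (n : ℕ) := by exact_mod_cast n.pos
    simp only [hL, if_pos this, hV, Int.cast_natCast]
  · intro y hy
    rcases lt_or_gt_of_ne hy with h | h
    · simp [hL, h, h.not_gt]
    · simp [hL, h, h.not_gt]

lemma tendsto_box_sum_of_im_neg [NeZero k] {c : ℕ} (hc : 0 < c) {β : ℂ} (hβ : β.im < 0) {p : ℕ}
    (hp : Odd p) {w : ℤ → ℤ → ℂ} {C : ℝ} (hC : ∀ y x, ‖w y x‖ ≤ C)
    (hw : ∀ y x, w y (x + (c * k : ℕ)) = w y x)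
    (h0 : ∀ y, ∑ i ∈ Finset.range (c * k), w y i = 0) {K : ℂ} {θ : DirichletCharacter ℂ k} {e : ℤ}
    (htr : ∀ m y : ℤ, ∑ i ∈ Finset.range (c * k), w y i * expInt (c * k) (-m * i) =
      (c * k : ℕ) * (K * ((-1) ^ m * θ (m : ZMod k) * θ (y : ZMod k) *
        expInt (c * k) (-(e * m * y))))) :
    Tendsto (fun M : ℕ ↦ ∑ y ∈ Finset.Ico (-((c * k * M : ℕ) : ℤ)) ((c * k * M : ℕ) : ℤ),
      ∑ x ∈ Finset.Ico (-((c * k * M : ℕ) : ℤ)) ((c * k * M : ℕ) : ℤ),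
        ((y : ℂ) ^ p)⁻¹ * (w y x / (β * y + x))) atTop
      (𝓝 (2 * Real.pi * I * K * H₁ ((-β - e) / c) (1 - p) θ)) := by
  have hk : 0 < k := NeZero.pos k
  have hN : 0 < c * k := Nat.mul_pos hc hk
  have hN' : ((c * k : ℕ) : ℂ) ≠ 0 := by exact_mod_cast hN.ne'
  have hc' : (c : ℂ) ≠ 0 := by exact_mod_cast hc.ne'
  have hk' : (k : ℂ) ≠ 0 := by exact_mod_cast hk.ne'
  have hp0 : p ≠ 0 := by
    rintro rfl
    exact absurd hp (by decide)
  set V : ℤ → ℂ := fun y ↦ 2 * Real.pi * I * K * (θ (y : ZMod k) * ∑' m : ℕ+, (-1 : ℂ) ^ (m : ℕ) *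
      θ ((m : ℕ) : ZMod k) * exp (2 * Real.pi * I * (m : ℕ) * y * ((-β - e) / c) / k)) with hV
  set L : ℤ → ℂ := fun y ↦ if 0 < y then V y else -V (-y) with hL
  have hexp : ∀ (m : ℕ+) (y : ℤ), expInt (c * k) (-(e * m * y)) *
      exp (-(2 * Real.pi * I * (m : ℕ) * (β * y) / (c * k : ℕ))) =
      exp (2 * Real.pi * I * (m : ℕ) * y * ((-β - e) / c) / k) := by
    intro m y
    rw [expInt, ← exp_add]
    congr 1
    push_cast
    field_simp
    ring
  have hlim : ∀ y ≠ 0, Tendsto (fun M : ℕ ↦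
      ∑ x ∈ Finset.Ico (-((c * k * M : ℕ) : ℤ)) ((c * k * M : ℕ) : ℤ),
      w y x / (β * y + x)) atTop (𝓝 (L y)) := by
    intro y hy
    rcases lt_or_gt_of_ne hy with hneg | hpos
    · have hu : 0 < (β * y).im := by
        have : (y : ℝ) < 0 := by exact_mod_cast hneg
        simp only [mul_im, intCast_re, intCast_im, mul_zero, zero_add]
        nlinarith
      convert tendsto_sum_div_add_of_im_pos hN (hw y) (h0 y) hu using 2
      simp only [hL, if_neg hneg.not_gt, hV]
      simp_rw [← tsum_mul_left]
      rw [← tsum_neg]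
      refine tsum_congr fun m ↦ ?_
      have htr' := htr (-m) y
      rw [neg_neg] at htr'
      have h3 := hexp m (-y)
      rw [show -(e * m * -y) = -(e * -m * y) by ring] at h3
      have h4 : exp (2 * Real.pi * I * (m : ℕ) * (β * y) / (c * k : ℕ)) =
          exp (-(2 * Real.pi * I * (m : ℕ) * (β * ((-y : ℤ) : ℂ)) / (c * k : ℕ))) := by
        push_cast
        ring_nf
      have h5 : θ ((-(m : ℕ) : ℤ) : ZMod k) * θ (y : ZMod k) =
          θ ((-y : ℤ) : ZMod k) * θ ((m : ℕ) : ZMod k) := by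
        rw [← map_mul, ← map_mul]
        push_cast
        ring_nf
      rw [htr', h4, ← h3, zpow_neg, ← inv_zpow, inv_neg, inv_one, zpow_natCast,
        mul_assoc ((-1 : ℂ) ^ (m : ℕ)) (θ ((-(m : ℕ) : ℤ) : ZMod k)), h5]
      field_simp
    · have hu : (β * y).im < 0 := by
        have : 0 < (y : ℝ) := by exact_mod_cast hpos
        simp only [mul_im, intCast_re, intCast_im, mul_zero, zero_add]
        nlinarith
      convert tendsto_sum_div_add_of_im_neg hN (hw y) (h0 y) hu using 2
      simp only [hL, if_pos hpos, hV]
      simp_rw [← tsum_mul_left]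
      refine tsum_congr fun m ↦ ?_
      rw [htr, ← hexp, zpow_natCast]
      push_cast
      field_simp
  obtain ⟨hs, ht⟩ := tendsto_box_sum hN hβ.ne hp0 hC hw h0 hlim
  rwa [tsum_int_eq_mul_H₁ θ hp (C := 2 * Real.pi * I * K) (τ := (-β - e) / c) ?_ ?_ hs] at ht
  · intro n
    have : (0 : ℤ) < (n : ℕ) := by exact_mod_cast n.pos
    simp only [hL, if_pos this, hV, Int.cast_natCast]
  · intro y hy
    rcases lt_or_gt_of_ne hy with h | h
    · simp [hL, h, h.not_gt]
    · simp [hL, h, h.not_gt]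

end Transformation

/-! ### The Bernoulli side and the general transformation formula -/

section Main

open Filter Topology Complex

lemma bernFun_add_int (m : ℕ) (x : ℝ) (n : ℤ) : bernFun m (x + n) = bernFun m x := by
  rw [bernFun, bernFun, Int.fract_add_intCast]

variable {k : ℕ} [NeZero k]

lemma bernFunChar_add_int_mul (m : ℕ) (ψ : DirichletCharacter ℂ k) (x : ℝ) (n : ℤ) :
    bernFunChar m ψ (x + n * k) = bernFunChar m ψ x := by
  have hk : (k : ℝ) ≠ 0 := by exact_mod_cast NeZero.ne k
  rw [bernFunChar, bernFunChar]
  congr 1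
  refine Finset.sum_congr rfl fun j _ ↦ ?_
  rw [← add_assoc, add_div, mul_div_assoc (n : ℝ), div_self hk, mul_one, bernFun_add_int]

/-- The power k^(m-p) cancels the k^(p-m) inside `bernFunChar`, and (j + dn/c)/k = (jc + dn)/(ck)
exposes the frequencies of the weight. -/
lemma g₂_eq_sum_range {c : ℕ} (hc : 0 < c) (hc2 : Even c) (d : ℤ) (z : ℂ) {p : ℕ}
    (ψ : DirichletCharacter ℂ k) :
    g₂ c d z p ψ = ∑ m ∈ Finset.Icc 1 p, ((p + 1).choose m : ℂ) * (-(c * z + d)) ^ (m - 1) *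
      ∑ n ∈ Finset.range (c * k), ∑ j ∈ Finset.range k,
        ((-1 : ℂ) ^ n * ψ (n : ZMod k) * star ψ (j : ZMod k)) *
        ((bernFun m (((n : ℤ) : ℝ) / (c * k : ℕ)) : ℂ) *
          (bernFun (p + 1 - m) (((j * c + d * n : ℤ) : ℝ) / (c * k : ℕ)) : ℂ)) := by
  have hk0 : (k : ℂ) ≠ 0 := by exact_mod_cast NeZero.ne k
  have hkr : (k : ℝ) ≠ 0 := by exact_mod_cast NeZero.ne k
  have hcr : (c : ℝ) ≠ 0 := by exact_mod_cast hc.ne'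
  have hNe : Even ((c * k : ℕ) : ℤ) := by
    push_cast
    exact (hc2.natCast (α := ℤ)).mul_right _
  rw [g₂]
  refine Finset.sum_congr rfl fun m hm ↦ ?_
  rw [Finset.mem_Icc] at hm
  have hper : ∀ n : ℤ, (-1 : ℂ) ^ (n + (c * k : ℕ)) * ψ ((n + (c * k : ℕ) : ℤ) : ZMod k) *
      bernFunChar (p + 1 - m) ψ ((d : ℝ) * ((n + (c * k : ℕ) : ℤ) : ℝ) / ((c : ℤ) : ℝ)) *
      (bernFun m (((n + (c * k : ℕ) : ℤ) : ℝ) / (((c : ℤ) : ℝ) * k)) : ℂ) =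
      (-1 : ℂ) ^ n * ψ (n : ZMod k) * bernFunChar (p + 1 - m) ψ ((d : ℝ) * n / ((c : ℤ) : ℝ)) *
      (bernFun m ((n : ℝ) / (((c : ℤ) : ℝ) * k)) : ℂ) := by
    intro n
    have q1 : (d : ℝ) * ((n + (c * k : ℕ) : ℤ) : ℝ) / ((c : ℤ) : ℝ) =
        (d : ℝ) * n / ((c : ℤ) : ℝ) + d * k := by
      push_cast
      field_simp
    have q2 : ((n + (c * k : ℕ) : ℤ) : ℝ) / (((c : ℤ) : ℝ) * k) =
        (n : ℝ) / (((c : ℤ) : ℝ) * k) + (1 : ℤ) := by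
      push_cast
      field_simp
    rw [neg_one_zpow_add_of_even hNe, char_add_mul, q1, q2, bernFunChar_add_int_mul,
      bernFun_add_int]
  have hsum := sum_Icc_eq_sum_range (f := fun n : ℤ ↦ (-1 : ℂ) ^ n * ψ (n : ZMod k) *
    bernFunChar (p + 1 - m) ψ ((d : ℝ) * n / ((c : ℤ) : ℝ)) *
      (bernFun m ((n : ℝ) / (((c : ℤ) : ℝ) * k)) : ℂ)) hper
  rw [show ((c : ℤ) : ℤ) * (k : ℤ) = ((c * k : ℕ) : ℤ) by push_cast; rfl, hsum, mul_assoc]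
  simp only [Int.cast_natCast]
  congr 1
  rw [Finset.mul_sum]
  refine Finset.sum_congr rfl fun n _ ↦ ?_
  rw [bernFunChar]
  have e1 : (k : ℂ) ^ ((m : ℤ) - (p : ℤ)) * (k : ℂ) ^ (((p + 1 - m : ℕ) : ℤ) - 1) = 1 := by
    rw [← zpow_add₀ hk0]
    convert zpow_zero (k : ℂ) using 2
    push_cast [show m ≤ p + 1 by lia]
    ring
  rw [zpow_natCast]
  have e2 : ∀ j : ℕ, (((j : ℝ) + (d : ℝ) * (n : ℝ) / (c : ℝ)) / k) =
      ((j * c + d * n : ℤ) : ℝ) / (c * k : ℕ) := by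
    intro j
    push_cast
    field_simp
  simp_rw [e2]
  rw [show ∀ A B S Q R : ℂ, A * (B * (R * S) * Q) = (A * R) * (B * S * Q) by intros; ring, e1,
    one_mul, Finset.mul_sum, Finset.sum_mul]
  refine Finset.sum_congr rfl fun j _ ↦ ?_
  push_cast
  ring

/-- For fixed n and j the box sum factors into two one-variable Fourier series. The sign (-1)^m is
the parity of the Bernoulli function, as the frequency in x is -n. -/
lemma tendsto_sum_weight_div_pow (ψ : DirichletCharacter ℂ k) {c : ℕ} (hc : 0 < c) (d : ℤ)
    {m l : ℕ} (hm : m ≠ 0) (hl : l ≠ 0) :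
    Tendsto (fun M : ℕ ↦ ∑ x ∈ Finset.Ico (-((c * k * M : ℕ) : ℤ)) ((c * k * M : ℕ) : ℤ),
      ∑ y ∈ Finset.Ico (-((c * k * M : ℕ) : ℤ)) ((c * k * M : ℕ) : ℤ),
        weight ψ c d x y / ((x : ℂ) ^ m * (y : ℂ) ^ l)) atTop
      (𝓝 ((-1) ^ m * (2 * Real.pi * I) ^ (m + l) / (m ! * l !) *
        ∑ n ∈ Finset.range (c * k), ∑ j ∈ Finset.range k,
        ((-1 : ℂ) ^ n * ψ (n : ZMod k) * star ψ (j : ZMod k)) *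
        ((bernFun m (((n : ℤ) : ℝ) / (c * k : ℕ)) : ℂ) *
          (bernFun l (((j * c + d * n : ℤ) : ℝ) / (c * k : ℕ)) : ℂ)))) := by
  have hN : 0 < c * k := Nat.mul_pos hc (NeZero.pos k)
  have h : ∀ n j : ℕ, Tendsto (fun M : ℕ ↦
      ((-1 : ℂ) ^ n * ψ (n : ZMod k) * star ψ (j : ZMod k)) *
      ((∑ x ∈ Finset.Ico (-((c * k * M : ℕ) : ℤ)) ((c * k * M : ℕ) : ℤ),
          expInt (c * k) (-n * x) / (x : ℂ) ^ m) *
        (∑ y ∈ Finset.Ico (-((c * k * M : ℕ) : ℤ)) ((c * k * M : ℕ) : ℤ),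
          expInt (c * k) ((j * c + d * n) * y) / (y : ℂ) ^ l))) atTop _ := fun n j ↦
    ((tendsto_sum_expInt_div_pow hN hm (-n)).mul
      (tendsto_sum_expInt_div_pow hN hl (j * c + d * n))).const_mul _
  have h2 := tendsto_finsetSum (Finset.range (c * k)) fun n _ ↦
    tendsto_finsetSum (Finset.range k) fun j _ ↦ h n j
  convert! h2 using 2
  · simp_rw [weight, Finset.sum_div]
    simp_rw [Finset.sum_mul_sum, Finset.mul_sum]
    rw [Finset.sum_congr rfl fun x _ ↦ Finset.sum_comm, Finset.sum_comm]
    refine Finset.sum_congr rfl fun n _ ↦ ?_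
    rw [Finset.sum_congr rfl fun x _ ↦ Finset.sum_comm, Finset.sum_comm]
    refine Finset.sum_congr rfl fun j _ ↦ ?_
    refine Finset.sum_congr rfl fun x _ ↦ Finset.sum_congr rfl fun y _ ↦ ?_
    rw [div_mul_div_comm, mul_div_assoc]
  · rw [Finset.mul_sum]
    refine Finset.sum_congr rfl fun n _ ↦ ?_
    rw [Finset.mul_sum]
    refine Finset.sum_congr rfl fun j _ ↦ ?_
    rw [Int.cast_neg, neg_div ((c * k : ℕ) : ℝ), bernFun_neg]
    push_cast
    rw [pow_add]
    ring

lemma weight_zero_right {ψ : DirichletCharacter ℂ k} (hψ : ψ.IsPrimitive) (hk : k ≠ 1) {c : ℕ}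
    (hc : 0 < c) (hc2 : Even c) (d x : ℤ) : weight ψ c d x 0 = 0 := by
  have hN : 0 < c * k := Nat.mul_pos hc (NeZero.pos k)
  have hk' : Nontrivial (ZMod k) := ZMod.nontrivial_iff.2 hk
  refine eq_zero_of_transform_eq_zero hN (f := fun x ↦ weight ψ c d x 0)
    (fun x ↦ weight_add_left hc d x 0) (fun m ↦ ?_) x
  have h := sum_weight_mul_expInt_left hψ hc hc2 d (-m) 0
  rw [neg_neg] at h
  rw [h, Int.cast_zero, MulChar.map_nonunit ψ not_isUnit_zero]
  ring

/-- Both congruence cases enter only through the shape of the transform in y, so they are treated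
together, with κ recording the character values that differ. -/
theorem transformation_of_weight_transform {ψ χ : DirichletCharacter ℂ k} (hψ : ψ.IsPrimitive)
    (hk : k ≠ 1) {p : ℕ} (hp : Odd p) {c : ℕ} (hc : 0 < c) (hc2 : Even c) {a b d : ℤ}
    (hdet : a * d - b * c = 1) {κ : ℂ}
    (htr : ∀ m x : ℤ, ∑ i ∈ Finset.range (c * k), weight ψ c d x i * expInt (c * k) (m * i) =
      (c * k : ℕ) * (κ * ((-1) ^ m * χ (m : ZMod k) * χ (x : ZMod k) * gauss (star χ) *
          expInt (c * k) (a * m * x)))) {z : ℂ} (hz : 0 < z.im) :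
    κ * (gauss (star χ) * (c * z + d) ^ (p - 1) * H₁ ((a * z + b) / (c * z + d)) (1 - p) χ) =
      ψ (-1) * (gauss (star ψ) * H₁ z (1 - p) ψ) +
        (2 * Real.pi * I) ^ p / ((p + 1)! : ℂ) * g₂ c d z p ψ := by
  have hN : 0 < c * k := Nat.mul_pos hc (NeZero.pos k)
  have hk' : Nontrivial (ZMod k) := ZMod.nontrivial_iff.2 hk
  have hc' : (c : ℂ) ≠ 0 := by exact_mod_cast hc.ne'
  have hcr : (0 : ℝ) < c := by exact_mod_cast hc
  have hp0 : p ≠ 0 := by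
    rintro rfl
    exact absurd hp (by decide)
  set α : ℂ := c * z + d with hα
  have hαim : 0 < α.im := by
    have : α.im = c * z.im := by simp [hα]
    rw [this]
    positivity
  have hα0 : α ≠ 0 := by
    rintro h
    rw [h] at hαim
    simp at hαim
  have hβim : 0 < (-α⁻¹).im := by
    rw [neg_im, inv_im, neg_div, neg_neg]
    exact div_pos hαim (normSq_pos.2 hα0)
  have hχ0 : χ (0 : ZMod k) = 0 := MulChar.map_nonunit χ not_isUnit_zero
  have hψ0 : ψ (0 : ZMod k) = 0 := MulChar.map_nonunit ψ not_isUnit_zero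
  have hmean_right : ∀ x, ∑ i ∈ Finset.range (c * k), weight ψ c d x i = 0 := by
    intro x
    have h := htr 0 x
    simpa [hχ0] using h
  have hleft := sum_weight_mul_expInt_left hψ hc hc2 d
  have hmean_left : ∀ y, ∑ i ∈ Finset.range (c * k), weight ψ c d i y = 0 := by
    intro y
    have h := hleft 0 y
    simpa [hψ0] using h
  have hw0 : ∀ y, weight ψ c d 0 y = 0 := by
    refine eq_zero_of_transform_eq_zero hN (fun y ↦ weight_add_right hc d 0 y) fun m ↦ ?_
    rw [htr, Int.cast_zero, hχ0]
    ring
  have hw0' : ∀ x, weight ψ c d x 0 = 0 := weight_zero_right hψ hk hc hc2 d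
  -- The choice β = -1/α is in the upper half plane, and α^(p-1) / (βx + y) = α^p / (αy - x) matches
  -- the first partial fraction term. Below, β = -α matches the second.
  have T1 := tendsto_box_sum_of_im_pos (k := k) hc hβim hp (w := fun x y ↦ weight ψ c d x y)
    (fun x y ↦ norm_weight_le ψ c d x y) (fun x y ↦ weight_add_right hc d x y) hmean_right
    (K := κ * gauss (star χ)) (θ := χ) (e := a) (fun m x ↦ by rw [htr]; ring)
  have T2 := tendsto_box_sum_of_im_neg (k := k) hc (β := -α) (by simpa using hαim) hp
    (w := fun y x ↦ weight ψ c d x y)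
    (fun y x ↦ norm_weight_le ψ c d x y) (fun y x ↦ weight_add_left hc d x y) hmean_left
    (K := ψ (-1) * gauss (star ψ)) (θ := ψ) (e := d) (fun m y ↦ by rw [hleft]; ring)
  have T3 := tendsto_finsetSum (Finset.Icc 1 p) fun m hm ↦
    (tendsto_sum_weight_div_pow ψ hc d (m := m) (l := p + 1 - m)
      (by rw [Finset.mem_Icc] at hm; lia) (by rw [Finset.mem_Icc] at hm; lia)).const_mul
        (α ^ (m - 1))
  have T12 := (T1.const_mul (α ^ (p - 1))).add T2
  have heq := tendsto_nhds_unique_of_eventuallyEq T12 T3 (Eventually.of_forall fun M ↦ ?_)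
  · have e1 : ((a : ℂ) + -α⁻¹) / c = (a * z + b) / α := by
      have hdet' : (a : ℂ) * d - b * c = 1 := by exact_mod_cast hdet
      field_simp
      rw [hα]
      linear_combination hdet'
    have e2 : (- -α - (d : ℂ)) / c = z := by
      rw [hα]
      field_simp
      ring
    rw [e1, e2] at heq
    rw [g₂_eq_sum_range hc hc2, ← hα]
    -- Converts 1/(m! (p+1-m)!) into a binomial coefficient over (p+1)! and splits (-1)^m as
    -- -(-1)^(m-1). The common factor -2πi then cancels against the two limits on the left.
    have e3 : ∀ m ∈ Finset.Icc 1 p, ∀ S : ℂ, α ^ (m - 1) *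
        ((-1) ^ m * (2 * Real.pi * I) ^ (m + (p + 1 - m)) / (m ! * (p + 1 - m)!) * S) =
        -(2 * Real.pi * I) * ((2 * Real.pi * I) ^ p / ((p + 1)! : ℂ) *
          (((p + 1).choose m : ℂ) * (-α) ^ (m - 1) * S)) := by
      intro m hm S
      rw [Finset.mem_Icc] at hm
      have hch := Nat.choose_mul_factorial_mul_factorial (show m ≤ p + 1 by lia)
      have hch' : ((p + 1).choose m : ℂ) * m ! * (p + 1 - m)! = (p + 1)! := by exact_mod_cast hch
      have f1 : ((m !: ℕ) : ℂ) ≠ 0 := by exact_mod_cast Nat.factorial_ne_zero m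
      have f2 : (((p + 1 - m)! : ℕ) : ℂ) ≠ 0 := by exact_mod_cast Nat.factorial_ne_zero _
      have f3 : (((p + 1)! : ℕ) : ℂ) ≠ 0 := by exact_mod_cast Nat.factorial_ne_zero _
      rw [show m + (p + 1 - m) = p + 1 by lia, neg_pow α]
      obtain ⟨i, rfl⟩ : ∃ i, m = i + 1 := ⟨m - 1, by lia⟩
      rw [Nat.add_sub_cancel, ← hch', pow_succ (-1 : ℂ) i, pow_succ _ p]
      have f4 : ((p + 1).choose (i + 1) : ℂ) ≠ 0 := by
        exact_mod_cast (Nat.choose_pos (by lia)).ne'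
      field_simp
    rw [Finset.sum_congr rfl fun m hm ↦ e3 m hm _, ← Finset.mul_sum, ← Finset.mul_sum] at heq
    refine mul_left_cancel₀ (neg_ne_zero.2 two_pi_I_ne_zero) ?_
    linear_combination heq
  · simp only
    rw [Finset.sum_comm (s := Finset.Ico (-((c * k * M : ℕ) : ℤ)) ((c * k * M : ℕ) : ℤ))
      (f := fun y x : ℤ ↦ ((y : ℂ) ^ p)⁻¹ * (weight ψ c d x y / (-α * y + x)))]
    simp_rw [Finset.mul_sum]
    rw [Finset.sum_comm (s := Finset.Icc 1 p), ← Finset.sum_add_distrib]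
    refine Finset.sum_congr rfl fun x _ ↦ ?_
    rw [Finset.sum_comm (s := Finset.Icc 1 p), ← Finset.sum_add_distrib]
    refine Finset.sum_congr rfl fun y _ ↦ ?_
    -- The partial fraction identity requires x and y nonzero; on the axes the weight vanishes, so
    -- both sides are 0.
    rcases eq_or_ne x 0 with rfl | hx
    · simp [hw0]
    rcases eq_or_ne y 0 with rfl | hy
    · simp [hw0']
    have hx' : (x : ℂ) ≠ 0 := by exact_mod_cast hx
    have hy' : (y : ℂ) ≠ 0 := by exact_mod_cast hy
    have hne : α * y - x ≠ 0 := by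
      intro h
      have h2 := congrArg im h
      simp only [sub_im, mul_im, intCast_re, intCast_im, mul_zero, zero_add, sub_zero,
        zero_im, mul_eq_zero] at h2
      rcases h2 with h2 | h2
      · exact hαim.ne' h2
      · exact hy (by exact_mod_cast h2)
    have hid := partial_fraction_identity hx' hy' hne hp0
    have e4 : ∑ m ∈ Finset.Icc 1 p,
        α ^ (m - 1) * (weight ψ c d x y / ((x : ℂ) ^ m * (y : ℂ) ^ (p + 1 - m))) =
        weight ψ c d x y * ∑ m ∈ Finset.Icc 1 p,
          α ^ (m - 1) / ((x : ℂ) ^ m * (y : ℂ) ^ (p + 1 - m)) := by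
      rw [Finset.mul_sum]
      refine Finset.sum_congr rfl fun m _ ↦ ?_
      ring
    rw [e4, ← hid]
    have e5 : -α⁻¹ * x + y = (α * y - x) / α := by
      field_simp
      ring
    have e6 : -α * y + x = -(α * y - x) := by ring
    rw [e5, e6, div_neg, div_div_eq_mul_div]
    have e7 : α ^ p = α ^ (p - 1) * α := by
      rw [← pow_succ, Nat.sub_add_cancel (by lia)]
    rw [e7]
    ring

end Main

end HardyBerndt

theorem mainTheorem4 {k : ℕ} [NeZero k] (hk : Odd k)
    (χ : DirichletCharacter ℂ k) (hprim : χ.IsPrimitive) (hχ : χ ≠ 1)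
    (p : ℕ) (hp : Odd p)
    (a b c d : ℤ) (hdet : a * d - b * c = 1) (hc : 0 < c) (hc2 : Even c) :
    ((a ≡ 0 [ZMOD k] ∧ d ≡ 0 [ZMOD k]) → ∀ z : ℂ, 0 < z.im →
      HardyBerndt.gauss (star χ) * (c * z + d) ^ (p - 1) *
          HardyBerndt.H₁ ((a * z + b) / (c * z + d)) (1 - p) χ =
        star χ (b : ZMod k) * χ (c : ZMod k) * HardyBerndt.gauss χ *
            HardyBerndt.H₁ z (1 - p) (star χ) +
          star χ ((-b : ℤ) : ZMod k) * χ (c : ZMod k) *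
            ((2 * Real.pi * Complex.I) ^ p / ((p + 1)! : ℂ)) *
            HardyBerndt.g₂ c d z p (star χ)) ∧
    ((b ≡ 0 [ZMOD k] ∧ c ≡ 0 [ZMOD k]) → ∀ z : ℂ, 0 < z.im →
      HardyBerndt.gauss (star χ) * (c * z + d) ^ (p - 1) *
          HardyBerndt.H₁ ((a * z + b) / (c * z + d)) (1 - p) χ =
        star χ (a : ZMod k) * χ (d : ZMod k) * HardyBerndt.gauss (star χ) *
            HardyBerndt.H₁ z (1 - p) χ +
          star χ (a : ZMod k) * χ ((-d : ℤ) : ZMod k) *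
            ((2 * Real.pi * Complex.I) ^ p / ((p + 1)! : ℂ)) *
            HardyBerndt.g₂ c d z p χ) := by
  have hk1 : k ≠ 1 := by
    rintro rfl
    exact hχ (DirichletCharacter.level_one χ)
  lift c to ℕ using hc.le
  have hc' : 0 < c := by exact_mod_cast hc
  have hc2' : Even c := by exact_mod_cast hc2
  have hneg := HardyBerndt.char_mul_star_self (ψ := χ) isUnit_neg_one
  have hdetk : (a : ZMod k) * d - b * c = 1 := by
    have := congrArg (Int.cast : ℤ → ZMod k) hdet
    push_cast at this
    exact this
  have hnegone : χ (-1) * χ (-1) = 1 := by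
    rw [← map_mul]
    simp
  have hstar : star χ (-1) = χ (-1) := by
    linear_combination (-star χ (-1)) * hnegone + χ (-1) * hneg
  constructor
  · rintro ⟨ha, hd⟩ z hz
    have ha' : (a : ZMod k) = 0 := by
      simpa using (ZMod.intCast_eq_intCast_iff a 0 k).2 ha
    have hd' : (d : ZMod k) = 0 := by
      simpa using (ZMod.intCast_eq_intCast_iff d 0 k).2 hd
    have hu : (b : ZMod k) * (-c) = 1 := by
      rw [ha', hd'] at hdetk
      linear_combination hdetk
    have hub : IsUnit (b : ZMod k) := .of_mul_eq_one _ hu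
    have huc : IsUnit (c : ZMod k) := .of_mul_eq_one (-b) (by linear_combination hu)
    have hb1 := HardyBerndt.char_mul_star_self (ψ := χ) hub
    have hc1 := HardyBerndt.char_mul_star_self (ψ := χ) huc
    have h := HardyBerndt.transformation_of_weight_transform
      (HardyBerndt.isPrimitive_star hprim) hk1 hp hc' hc2' hdet
      (HardyBerndt.weight_right_transform_of_ad hprim hc' hc2' hdet ha' hd') hz
    rw [star_star, hstar] at h
    have e : star χ ((-b : ℤ) : ZMod k) = χ (-1) * star χ (b : ZMod k) := by
      rw [← hstar, ← map_mul]
      simp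
    rw [e]
    simp only [Int.cast_natCast] at h ⊢
    set A := HardyBerndt.gauss (star χ) * (c * z + d) ^ (p - 1) *
      HardyBerndt.H₁ ((a * z + b) / (c * z + d)) (1 - p) χ
    -- The inverse of κ: the character values at -1, b and c are units, with inverses given by
    -- conjugation. Multiplying by it isolates the left side of the claim.
    have hone : χ (-1) * χ (c : ZMod k) * star χ (b : ZMod k) *
        (χ (-1) * χ (b : ZMod k) * star χ (c : ZMod k)) = 1 := by
      calc _ = (χ (-1) * χ (-1)) * (χ (b : ZMod k) * star χ (b : ZMod k)) *
            (χ (c : ZMod k) * star χ (c : ZMod k)) := by ring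
        _ = 1 := by rw [hnegone, hb1, hc1]; ring
    linear_combination (χ (-1) * χ (c : ZMod k) * star χ (b : ZMod k)) * h - A * hone +
      χ (c : ZMod k) * star χ (b : ZMod k) * HardyBerndt.gauss χ *
        HardyBerndt.H₁ z (1 - p) (star χ) * hnegone
  · rintro ⟨hb, hck⟩ z hz
    have hb' : (b : ZMod k) = 0 := by
      simpa using (ZMod.intCast_eq_intCast_iff b 0 k).2 hb
    have hck' : (c : ZMod k) = 0 := by
      simpa using (ZMod.intCast_eq_intCast_iff c 0 k).2 hck
    have hu : (a : ZMod k) * d = 1 := by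
      rw [hb', hck'] at hdetk
      linear_combination hdetk
    have ha1 := HardyBerndt.char_mul_star_self (ψ := χ) (IsUnit.of_mul_eq_one _ hu)
    have hd1 := HardyBerndt.char_mul_star_self (ψ := χ)
      (IsUnit.of_mul_eq_one (a : ZMod k) (by rw [mul_comm]; exact hu))
    have h := HardyBerndt.transformation_of_weight_transform hprim hk1 hp hc' hc2' hdet
      (HardyBerndt.weight_right_transform_of_bc hprim hc' hc2' hdet hb' hck') hz
    have e : χ ((-d : ℤ) : ZMod k) = χ (-1) * χ (d : ZMod k) := by
      rw [← map_mul]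
      simp
    rw [e]
    simp only [Int.cast_natCast] at h ⊢
    set A := HardyBerndt.gauss (star χ) * (c * z + d) ^ (p - 1) *
      HardyBerndt.H₁ ((a * z + b) / (c * z + d)) (1 - p) χ
    have hone : χ (-1) * χ (d : ZMod k) * star χ (a : ZMod k) *
        (χ (-1) * χ (a : ZMod k) * star χ (d : ZMod k)) = 1 := by
      calc _ = (χ (-1) * χ (-1)) * (χ (a : ZMod k) * star χ (a : ZMod k)) *
            (χ (d : ZMod k) * star χ (d : ZMod k)) := by ring
        _ = 1 := by rw [hnegone, ha1, hd1]; ring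
    linear_combination (χ (-1) * χ (d : ZMod k) * star χ (a : ZMod k)) * h - A * hone +
      χ (d : ZMod k) * star χ (a : ZMod k) * HardyBerndt.gauss (star χ) *
        HardyBerndt.H₁ z (1 - p) χ * hnegone
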